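/- **Theorem (Geometric resolvent inequality).** *Setting.* A metric graph $\Gamma=(E,V,l,i,j)$ consists of countable sets $E$ of edges and $V$ of vertices, lengths $l:E\to(0,\infty)$ and maps $i,j:E\to V$ giving the start and the end vertex of each edge (loops and multiple edges are allowed); the edge $e$ is identified with $I_e=(0,l(e))$. Assume that every vertex has finite degree and $0<l_-\le l(e)\le l_+<\infty$ for all $e$. Let $E_v=\{(e,0): i(e)=v\}\cup\{(e,l(e)): j(e)=v\}$, and for a family $f=(f_e)$ of functions with boundary values put $\mathrm{tr}_v f=(f_e(t))_{(e,t)\in E_v}$ and $\mathrm{str}_v f=(\mathrm{sgn}(e,t)f_e(t))_{(e,t)\in E_v}$, where $\mathrm{sgn}(e,0)=1$ and $\mathrm{sgn}(e,l(e))=-1$. Let $S>0$. For each $v\in V$ let $P_v$ be an orthogonal projection in $\mathbb C^{E_v}$ and $L_v$ a self-adjoint operator on $\mathrm{ran}(1-P_v)$ with $L_v\ge -S$. Let $q_-<q_+$ and $0<c_-\le c_+$; let $\nu_e:I_e\to\mathbb R$ be measurable with $c_-\le\nu_e\le c_+$ almost everywhere, and let $\omega\in[q_-,q_+]^E$ be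 any configuration. For $F\subset E$ finite let $\Gamma_F$ be the induced subgraph with vertex set $V_F=\{i(e),j(e):e\in F\}$ and $X_F=\bigcup_{e\in F}\{e\}\times I_e$. A vertex of $\Gamma_F$ is *inner* ($v\in \mathrm{int}\,F$) if all edges of $E$ incident to it lie in $F$, and a *boundary* vertex ($v\in\partial F$) otherwise. Let $H^F$ be the operator in $L^2(X_F)=\bigoplus_{e\in F}L^2(I_e)$ given by $$H^Ff=(-f_e''+\omega_e\nu_ef_e)_{e\in F}$$ on all $f\in\bigoplus_{e\in F}W^{2,2}(I_e)$ such that $\mathrm{tr}_vf\in\mathrm{ran}(1-P_v)$ and $L_v\mathrm{tr}_vf=(1-P_v)\,\mathrm{str}_v(f')$ for $v\in\mathrm{int}\,F$, and such that all boundary values of $f$ at vertices $v\in\partial F$ vanish. Let $\varrho(H^F)$ denote its resolvent set. *Statement.* For all $S,l_-,q_\pm,c_\pm$ as above and every bounded interval $I\subset\mathbb R$ there is a constant $C_{\mathrm{GRU}}>0$, depending only on these data, such that the following holds for every $\Gamma$, $(P_v,L_v)_v$, $(\nu_e)_e$ and $\omega$ as above (in particular $C_{\mathrm{GRU}}$ depends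 neither on $l_+$ nor on the sets and the function below). Let $E_1\subset E_2$ be finite sets of edges, $\lambda\in\varrho(H^{E_1})\cap\varrho(H^{E_2})\cap I$, $E_A\subset E_1$ and $E_B\subset E_2\setminus E_1$. Suppose that there are sets $E_3\subset E_4\subset E_1$ with $\partial E_3\subset\mathrm{int}\,E_4$ and $E_A\cap E_4=\varnothing$, and a function $\varphi=(\varphi_e)_{e\in E_1}$, $\varphi_e\in C^\infty(I_e)$, which is constant on a neighbourhood of each vertex of $\Gamma_{E_1}$ (the same constant on all edges at that vertex), vanishes near each boundary vertex of $\Gamma_{E_1}$, equals $1$ on $X_{E_A}$, and satisfies $\mathrm{supp}\,\varphi'\subset X_{E_3}$. Then $$\big\|\mathbf 1_{X_{E_B}}(H^{E_2}-\lambda)^{-1}\mathbf 1_{X_{E_A}}\big\|\le C_{\mathrm{GRU}}\,\big\|\mathbf 1_{X_{E_B}}(H^{E_2}-\lambda)^{-1}\mathbf 1_{X_{E_4}}\big\|\,\big\|\mathbf 1_{X_{E_4}}(H^{E_1}-\lambda)^{-1}\mathbf 1_{X_{E_A}}\big\|.$$ -/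

import Mathlib

open MeasureTheory Set
open scoped ContDiff

noncomputable section

/-! ### Resolvents of unbounded operators -/

/-- `R` is the bounded, everywhere defined inverse of `T - z`, i.e. `T - z : dom T → H` is
bijective and `R` is its inverse. -/
def IsResolventAt {H : Type*} [NormedAddCommGroup H] [NormedSpace ℂ H]
    (T : H →ₗ.[ℂ] H) (z : ℂ) (R : H →L[ℂ] H) : Prop :=
  ∀ f g : H, R g = f ↔ ∃ hf : f ∈ T.domain, T ⟨f, hf⟩ - z • f = g

/-- The resolvent set of an unbounded operator. -/
def resSet {H : Type*} [NormedAddCommGroup H] [NormedSpace ℂ H] (T : H →ₗ.[ℂ] H) : Set ℂ :=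
  {z | ∃ R : H →L[ℂ] H, IsResolventAt T z R}

open scoped Classical in
/-- The resolvent `(T - z)⁻¹` (set to `0` for `z` in the spectrum). -/
def resOp {H : Type*} [NormedAddCommGroup H] [NormedSpace ℂ H] (T : H →ₗ.[ℂ] H) (z : ℂ) :
    H →L[ℂ] H :=
  if h : z ∈ resSet T then h.choose else 0

theorem isResolventAt_resOp {H : Type*} [NormedAddCommGroup H] [NormedSpace ℂ H]
    {T : H →ₗ.[ℂ] H} {z : ℂ} (h : z ∈ resSet T) : IsResolventAt T z (resOp T z) := by
  rw [resOp, dif_pos h]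
  exact h.choose_spec

/-! ### Sobolev functions on an interval -/

/-- `L²(0, ℓ)`. -/
abbrev L2Interval (ℓ : ℝ) : Type := Lp ℂ 2 (volume.restrict (Ioo (0 : ℝ) ℓ))

/-- `g ∈ L²(0, ℓ)` is the weak derivative of `f ∈ L²(0, ℓ)`. Thus `f ∈ W^{1,2}(0, ℓ)` iff such a
`g` exists, and `f ∈ W^{2,2}(0, ℓ)` iff moreover `g ∈ W^{1,2}(0, ℓ)`. -/
def HasWeakDeriv {ℓ : ℝ} (f g : L2Interval ℓ) : Prop :=
  ∀ η : ℝ → ℝ, ContDiff ℝ ∞ η → HasCompactSupport η → tsupport η ⊆ Ioo 0 ℓ →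
    ∫ t in Ioo 0 ℓ, deriv η t • f t = - ∫ t in Ioo 0 ℓ, η t • g t

/-- `u` is a representative of `f` which is continuous up to the boundary of `(0, ℓ)`, so that
`u 0` and `u ℓ` are the boundary values of `f`. -/
def IsContRep {ℓ : ℝ} (f : L2Interval ℓ) (u : ℝ → ℂ) : Prop :=
  ContinuousOn u (Icc 0 ℓ) ∧ ∀ᵐ t ∂(volume.restrict (Ioo (0 : ℝ) ℓ)), f t = u t

theorem integrable_test_smul {ℓ : ℝ} (f : L2Interval ℓ) {η : ℝ → ℝ} (hη : Continuous η)
    (hc : HasCompactSupport η) :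
    Integrable (fun t => η t • f t) (volume.restrict (Ioo (0 : ℝ) ℓ)) := by
  have hf : Integrable f (volume.restrict (Ioo (0 : ℝ) ℓ)) :=
    (Lp.memLp f).integrable (by norm_num)
  obtain ⟨C, hC⟩ := hc.exists_bound_of_continuous hη
  exact hf.bdd_smul C hη.aestronglyMeasurable (Filter.Eventually.of_forall hC)

theorem HasWeakDeriv.add {ℓ : ℝ} {f g f' g' : L2Interval ℓ} (hf : HasWeakDeriv f f')
    (hg : HasWeakDeriv g g') : HasWeakDeriv (f + g) (f' + g') := by
  intro η h1 h2 h3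
  have hd : Continuous (deriv η) := h1.continuous_deriv (by simp)
  have e1 : ∫ t in Ioo 0 ℓ, deriv η t • (f + g : L2Interval ℓ) t =
      ∫ t in Ioo 0 ℓ, (deriv η t • f t + deriv η t • g t) := by
    refine integral_congr_ae ?_
    filter_upwards [Lp.coeFn_add f g] with t ht
    rw [ht, Pi.add_apply, smul_add]
  have e2 : ∫ t in Ioo 0 ℓ, η t • (f' + g' : L2Interval ℓ) t =
      ∫ t in Ioo 0 ℓ, (η t • f' t + η t • g' t) := by
    refine integral_congr_ae ?_
    filter_upwards [Lp.coeFn_add f' g'] with t ht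
    rw [ht, Pi.add_apply, smul_add]
  rw [e1, e2, integral_add (integrable_test_smul f hd h2.deriv)
    (integrable_test_smul g hd h2.deriv), integral_add
    (integrable_test_smul f' h1.continuous h2) (integrable_test_smul g' h1.continuous h2),
    hf η h1 h2 h3, hg η h1 h2 h3, neg_add]

theorem HasWeakDeriv.smul {ℓ : ℝ} {f f' : L2Interval ℓ} (c : ℂ) (hf : HasWeakDeriv f f') :
    HasWeakDeriv (c • f) (c • f') := by
  intro η h1 h2 h3
  have e1 : ∫ t in Ioo 0 ℓ, deriv η t • (c • f : L2Interval ℓ) t =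
      ∫ t in Ioo 0 ℓ, c • (deriv η t • f t) := by
    refine integral_congr_ae ?_
    filter_upwards [Lp.coeFn_smul c f] with t ht
    rw [ht, Pi.smul_apply, smul_comm]
  have e2 : ∫ t in Ioo 0 ℓ, η t • (c • f' : L2Interval ℓ) t =
      ∫ t in Ioo 0 ℓ, c • (η t • f' t) := by
    refine integral_congr_ae ?_
    filter_upwards [Lp.coeFn_smul c f'] with t ht
    rw [ht, Pi.smul_apply, smul_comm]
  rw [e1, e2, integral_smul, integral_smul, hf η h1 h2 h3, smul_neg]

/-- Weak derivatives are unique. -/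
theorem HasWeakDeriv.eq_zero {ℓ : ℝ} {f f' : L2Interval ℓ} (hf : HasWeakDeriv f f')
    (h0 : f = 0) : f' = 0 := by
  subst h0
  have hi : Integrable f' (volume.restrict (Ioo (0 : ℝ) ℓ)) :=
    (Lp.memLp f').integrable (by norm_num)
  have key := isOpen_Ioo.ae_eq_zero_of_integral_contDiff_smul_eq_zero (μ := volume) (f := f')
    (U := Ioo (0 : ℝ) ℓ) (IntegrableOn.locallyIntegrableOn hi) (by
      intro η h1 h2 h3
      have h4 := hf η h1 h2 h3
      have h5 : ∫ t in Ioo 0 ℓ, deriv η t • (0 : L2Interval ℓ) t = 0 := by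
        rw [integral_eq_zero_of_ae]
        filter_upwards [Lp.coeFn_zero ℂ 2 (volume.restrict (Ioo (0 : ℝ) ℓ))] with t ht
        rw [ht]
        simp
      rw [h5, zero_eq_neg] at h4
      rw [← h4, setIntegral_eq_integral_of_forall_compl_eq_zero]
      intro t ht
      rw [image_eq_zero_of_notMem_tsupport (fun hh => ht (h3 hh)), zero_smul])
  apply Lp.ext
  have k2 := (ae_restrict_iff' (measurableSet_Ioo (a := (0 : ℝ)) (b := ℓ))).2 key
  filter_upwards [k2, Lp.coeFn_zero ℂ 2 (volume.restrict (Ioo (0 : ℝ) ℓ))] with t h1 h2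
  rw [h1, h2]
  rfl

theorem IsContRep.add {ℓ : ℝ} {f g : L2Interval ℓ} {u v : ℝ → ℂ} (hf : IsContRep f u)
    (hg : IsContRep g v) : IsContRep (f + g) (fun t => u t + v t) := by
  refine ⟨hf.1.add hg.1, ?_⟩
  filter_upwards [Lp.coeFn_add f g, hf.2, hg.2] with t h1 h2 h3
  rw [h1, Pi.add_apply, h2, h3]

theorem IsContRep.smul {ℓ : ℝ} {f : L2Interval ℓ} {u : ℝ → ℂ} (c : ℂ) (hf : IsContRep f u) :
    IsContRep (c • f) (fun t => c * u t) := by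
  refine ⟨hf.1.const_smul c, ?_⟩
  filter_upwards [Lp.coeFn_smul c f, hf.2] with t h1 h2
  rw [h1, Pi.smul_apply, h2, smul_eq_mul]

/-! ### Metric graphs -/

/-- A metric graph, all of whose edges have finite length: the edge `e` is identified with the
interval `(0, l e)`, starts at `i e` and ends at `j e`. Loops and multiple edges are allowed. -/
structure MetricGraph (V E : Type*) where
  l : E → ℝ
  l_pos : ∀ e, 0 < l e
  i : E → V
  j : E → V

namespace MetricGraph

/-- The vertex at the start (`false`) or at the end (`true`) of an edge. -/
def vertexAt {V E : Type*} (G : MetricGraph V E) (p : E × Bool) : V :=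
  if p.2 then G.j p.1 else G.i p.1

/-- The position in `[0, l e]` of the start (`false`) or the end (`true`) of an edge. -/
def posAt {V E : Type*} (G : MetricGraph V E) (p : E × Bool) : ℝ :=
  if p.2 then G.l p.1 else 0

/-- The sign of an edge end: `1` at the start and `-1` at the end of an edge. -/
def sgnAt {E : Type*} (p : E × Bool) : ℂ := if p.2 then -1 else 1

/-- The set `E_v` of edge ends at the vertex `v`; a loop at `v` contributes two of them. -/
abbrev Star {V E : Type*} (G : MetricGraph V E) (v : V) : Type _ :=
  {p : E × Bool // G.vertexAt p = v}

/-- The relation `e ∼ v`. -/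
def Incident {V E : Type*} (G : MetricGraph V E) (e : E) (v : V) : Prop := G.i e = v ∨ G.j e = v

/-- The vertices of the subgraph induced by the edge set `F`. -/
def verts {V E : Type*} (G : MetricGraph V E) (F : Finset E) : Set V :=
  {v | ∃ e ∈ F, G.Incident e v}

/-- Inner vertices of the induced subgraph: all incident edges of the whole graph are in `F`. -/
def innerVerts {V E : Type*} (G : MetricGraph V E) (F : Finset E) : Set V :=
  {v | v ∈ G.verts F ∧ ∀ e, G.Incident e v → e ∈ F}

/-- Boundary vertices of the induced subgraph: some incident edge lies in `F`, another one does
not. -/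
def bdryVerts {V E : Type*} (G : MetricGraph V E) (F : Finset E) : Set V :=
  {v | (∃ e ∈ F, G.Incident e v) ∧ ∃ e, e ∉ F ∧ G.Incident e v}

/-- The Hilbert space `L²(X_F) = ⨁_{e ∈ F} L²(0, l e)` of a finite induced subgraph. -/
abbrev L2 {V E : Type*} (G : MetricGraph V E) (F : Finset E) : Type _ :=
  PiLp 2 (fun e : {e // e ∈ F} => L2Interval (G.l e))

open scoped Classical in
/-- Multiplication by the indicator function of `X_A` on `L²(X_F)`. -/
def ind {V E : Type*} (G : MetricGraph V E) (F A : Finset E) : G.L2 F →L[ℂ] G.L2 F :=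
  LinearMap.mkContinuous
    { toFun := fun f => WithLp.toLp 2 (fun e => if (e : E) ∈ A then f e else 0)
      map_add' := by
        intro f g
        ext1 e
        by_cases h : (e : E) ∈ A <;> simp [h]
      map_smul' := by
        intro c f
        ext1 e
        by_cases h : (e : E) ∈ A <;> simp [h] }
    1 (by
      intro f
      rw [one_mul, PiLp.norm_eq_of_L2, PiLp.norm_eq_of_L2]
      apply Real.sqrt_le_sqrt
      apply Finset.sum_le_sum
      intro e _
      by_cases h : (e : E) ∈ A <;> simp [h])

section Operators

variable {V E : Type*} (G : MetricGraph V E)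

/-- The trace `tr_v` of a family of functions on the edges (continuous up to the ends). -/
def tr (v : V) (u : E → ℝ → ℂ) : EuclideanSpace ℂ (G.Star v) :=
  WithLp.toLp 2 (fun p => u p.1.1 (G.posAt p.1))

/-- The signed trace `str_v`. -/
def str (v : V) (u : E → ℝ → ℂ) : EuclideanSpace ℂ (G.Star v) :=
  WithLp.toLp 2 (fun p => sgnAt p.1 * u p.1.1 (G.posAt p.1))

/-- Vertex conditions `(P, L)` with lower bound `-S`: orthogonal projections `P v` on `ℂ^{E_v}` and
self-adjoint operators `L v ≥ -S` on the range of `1 - P v`, that is, on the kernel of `P v`. (For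
finite vertex degree these spaces are finite dimensional, and `L v` is everywhere defined there.) -/
structure VertexCond [∀ v, Fintype (G.Star v)] (S : ℝ) where
  P : ∀ v, EuclideanSpace ℂ (G.Star v) →L[ℂ] EuclideanSpace ℂ (G.Star v)
  isProj : ∀ v, IsStarProjection (P v)
  L : ∀ v, (P v).ker →ₗ[ℂ] (P v).ker
  symm : ∀ v (x y : (P v).ker), inner ℂ (L v x : EuclideanSpace ℂ (G.Star v)) y =
    inner ℂ (x : EuclideanSpace ℂ (G.Star v)) (L v y)
  lower : ∀ v (x : (P v).ker), -S * ‖(x : EuclideanSpace ℂ (G.Star v))‖ ^ 2 ≤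
    (inner ℂ (L v x : EuclideanSpace ℂ (G.Star v)) x).re

variable [∀ v, Fintype (G.Star v)] {S : ℝ}

/-- The vertex condition at `v` for the boundary values `x` of a function and the signed boundary
values `y` of its derivative: `x ∈ dom L_v` and `L_v x = (1 - P_v) y`. -/
def VertexCond.Holds {G : MetricGraph V E} [∀ v, Fintype (G.Star v)] (B : G.VertexCond S) (v : V)
    (x y : EuclideanSpace ℂ (G.Star v)) : Prop :=
  ∃ hx : x ∈ (B.P v).ker, (B.L v ⟨x, hx⟩ : EuclideanSpace ℂ (G.Star v)) = y - B.P v y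

/-- `f ∈ W^{2,2}(X_F)` with first and second derivative `f₁`, `f₂`, satisfying the vertex
conditions at the inner vertices and Dirichlet conditions at the boundary vertices of the subgraph
induced by `F`. -/
def InDomain (B : G.VertexCond S) (F : Finset E) (f f₁ f₂ : G.L2 F) : Prop :=
  (∀ e, HasWeakDeriv (f e) (f₁ e)) ∧ (∀ e, HasWeakDeriv (f₁ e) (f₂ e)) ∧
  ∃ u u₁ : E → ℝ → ℂ, (∀ e, IsContRep (f e) (u e)) ∧ (∀ e, IsContRep (f₁ e) (u₁ e)) ∧
    (∀ v ∈ G.innerVerts F, B.Holds v (G.tr v u) (G.str v u₁)) ∧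
    (∀ v ∈ G.bdryVerts F, ∀ p : G.Star v, p.1.1 ∈ F → u p.1.1 (G.posAt p.1) = 0)

/-- The relation `f ∈ dom(H^F)` and `h = H^F f = -f'' + W f`. -/
def OpRel (B : G.VertexCond S) (W : E → ℝ → ℝ) (F : Finset E) (f h : G.L2 F) : Prop :=
  ∃ f₁ f₂ : G.L2 F, G.InDomain B F f f₁ f₂ ∧
    ∀ e, ∀ᵐ t ∂(volume.restrict (Ioo (0 : ℝ) (G.l e))),
      h e t = - f₂ e t + (W e t : ℂ) * f e t

variable {G}

theorem VertexCond.Holds.add {B : G.VertexCond S} {v : V} {x y x' y' : EuclideanSpace ℂ (G.Star v)}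
    (h : B.Holds v x y) (h' : B.Holds v x' y') : B.Holds v (x + x') (y + y') := by
  obtain ⟨hx, e⟩ := h
  obtain ⟨hx', e'⟩ := h'
  refine ⟨add_mem hx hx', ?_⟩
  have : (⟨x + x', add_mem hx hx'⟩ : (B.P v).ker) = ⟨x, hx⟩ + ⟨x', hx'⟩ := rfl
  rw [this, map_add, Submodule.coe_add, e, e', map_add]
  abel

theorem VertexCond.Holds.smul {B : G.VertexCond S} {v : V} {x y : EuclideanSpace ℂ (G.Star v)}
    (c : ℂ) (h : B.Holds v x y) : B.Holds v (c • x) (c • y) := by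
  obtain ⟨hx, e⟩ := h
  refine ⟨Submodule.smul_mem _ c hx, ?_⟩
  have : (⟨c • x, Submodule.smul_mem _ c hx⟩ : (B.P v).ker) = c • ⟨x, hx⟩ := rfl
  rw [this, map_smul, Submodule.coe_smul, e, map_smul, smul_sub]

theorem OpRel.add {B : G.VertexCond S} {W : E → ℝ → ℝ} {F : Finset E} {f h f' h' : G.L2 F}
    (H : G.OpRel B W F f h) (H' : G.OpRel B W F f' h') : G.OpRel B W F (f + f') (h + h') := by
  obtain ⟨f₁, f₂, ⟨d1, d2, u, u₁, r, r₁, hi, hb⟩, he⟩ := H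
  obtain ⟨f₁', f₂', ⟨d1', d2', u', u₁', r', r₁', hi', hb'⟩, he'⟩ := H'
  refine ⟨f₁ + f₁', f₂ + f₂', ⟨fun e => (d1 e).add (d1' e), fun e => (d2 e).add (d2' e),
    fun e t => u e t + u' e t, fun e t => u₁ e t + u₁' e t, fun e => (r e).add (r' e),
    fun e => (r₁ e).add (r₁' e), fun v hv => ?_, fun v hv p hp => ?_⟩, fun e => ?_⟩
  · have e1 : G.tr v (fun e t => u e t + u' e t) = G.tr v u + G.tr v u' := rfl
    have e2 : G.str v (fun e t => u₁ e t + u₁' e t) = G.str v u₁ + G.str v u₁' := by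
      ext p
      exact mul_add _ _ _
    rw [e1, e2]
    exact (hi v hv).add (hi' v hv)
  · change u p.1.1 (G.posAt p.1) + u' p.1.1 (G.posAt p.1) = 0
    rw [hb v hv p hp, hb' v hv p hp, add_zero]
  · filter_upwards [he e, he' e, Lp.coeFn_add (h e) (h' e), Lp.coeFn_add (f e) (f' e),
      Lp.coeFn_add (f₂ e) (f₂' e)] with t a1 a2 a3 a4 a5
    simp only [PiLp.add_apply, a3, a4, a5, Pi.add_apply, a1, a2]
    ring

theorem OpRel.smul {B : G.VertexCond S} {W : E → ℝ → ℝ} {F : Finset E} {f h : G.L2 F} (c : ℂ)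
    (H : G.OpRel B W F f h) : G.OpRel B W F (c • f) (c • h) := by
  obtain ⟨f₁, f₂, ⟨d1, d2, u, u₁, r, r₁, hi, hb⟩, he⟩ := H
  refine ⟨c • f₁, c • f₂, ⟨fun e => (d1 e).smul c, fun e => (d2 e).smul c,
    fun e t => c * u e t, fun e t => c * u₁ e t, fun e => (r e).smul c,
    fun e => (r₁ e).smul c, fun v hv => ?_, fun v hv p hp => ?_⟩, fun e => ?_⟩
  · have e1 : G.tr v (fun e t => c * u e t) = c • G.tr v u := rfl
    have e2 : G.str v (fun e t => c * u₁ e t) = c • G.str v u₁ := by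
      ext p
      exact mul_left_comm _ _ _
    rw [e1, e2]
    exact (hi v hv).smul c
  · change c * u p.1.1 (G.posAt p.1) = 0
    rw [hb v hv p hp, mul_zero]
  · filter_upwards [he e, Lp.coeFn_smul c (h e), Lp.coeFn_smul c (f e),
      Lp.coeFn_smul c (f₂ e)] with t a1 a3 a4 a5
    simp only [PiLp.smul_apply, a3, a4, a5, Pi.smul_apply, a1, smul_eq_mul]
    ring

theorem OpRel.zero {B : G.VertexCond S} {W : E → ℝ → ℝ} {F : Finset E} :
    G.OpRel B W F 0 0 := by
  have d0 : ∀ ℓ : ℝ, HasWeakDeriv (0 : L2Interval ℓ) 0 := by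
    intro ℓ η _ _ _
    have h5 : ∀ η' : ℝ → ℝ, ∫ t in Ioo 0 ℓ, η' t • (0 : L2Interval ℓ) t = 0 := by
      intro η'
      rw [integral_eq_zero_of_ae]
      filter_upwards [Lp.coeFn_zero ℂ 2 (volume.restrict (Ioo (0 : ℝ) ℓ))] with t ht
      rw [ht]
      simp
    rw [h5, h5, neg_zero]
  have r0 : ∀ ℓ : ℝ, IsContRep (0 : L2Interval ℓ) (fun _ => 0) := fun ℓ =>
    ⟨continuousOn_const, by
      filter_upwards [Lp.coeFn_zero ℂ 2 (volume.restrict (Ioo (0 : ℝ) ℓ))] with t ht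
      rw [ht]
      rfl⟩
  refine ⟨0, 0, ⟨fun e => d0 _, fun e => d0 _, fun _ _ => 0, fun _ _ => 0, fun e => r0 _,
    fun e => r0 _, fun v hv => ⟨?_, ?_⟩, fun v hv p hp => rfl⟩, fun e => ?_⟩
  · exact Submodule.zero_mem _
  · have : G.str v (fun _ _ => 0) = 0 := by
      ext p
      simp [str]
    rw [this, map_zero, sub_zero]
    exact congrArg Subtype.val (map_zero (B.L v))
  · filter_upwards [Lp.coeFn_zero ℂ 2 (volume.restrict (Ioo (0 : ℝ) (G.l e)))] with t ht
    change (0 : L2Interval (G.l e)) t = - (0 : L2Interval (G.l e)) t +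
      (W e t : ℂ) * (0 : L2Interval (G.l e)) t
    rw [ht]
    simp

/-- The operator is single-valued. -/
theorem OpRel.eq_zero {B : G.VertexCond S} {W : E → ℝ → ℝ} {F : Finset E} {f h : G.L2 F}
    (H : G.OpRel B W F f h) (hf : f = 0) : h = 0 := by
  obtain ⟨f₁, f₂, ⟨d1, d2, -⟩, he⟩ := H
  subst hf
  ext1 e
  have h1 := (d1 e).eq_zero rfl
  have h2 := (d2 e).eq_zero h1
  apply Lp.ext
  filter_upwards [he e, Lp.coeFn_zero ℂ 2 (volume.restrict (Ioo (0 : ℝ) (G.l e)))] with t a1 a2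
  rw [a1, h2]
  change - (0 : L2Interval (G.l e)) t + (W e t : ℂ) * (0 : L2Interval (G.l e)) t =
    (0 : L2Interval (G.l e)) t
  rw [a2]
  simp

variable (G)

/-- The graph `{(f, H^F f) | f ∈ dom(H^F)}`. -/
def opGraph (B : G.VertexCond S) (W : E → ℝ → ℝ) (F : Finset E) :
    Submodule ℂ (G.L2 F × G.L2 F) where
  carrier := {q | G.OpRel B W F q.1 q.2}
  zero_mem' := OpRel.zero
  add_mem' := fun h h' => OpRel.add h h'
  smul_mem' := fun c _ h => OpRel.smul c h

/-- `H^F`, the restriction of the operator `-d²/dx² + W` with vertex conditions `B` to the finite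
subgraph induced by `F`, with Dirichlet conditions at the boundary vertices, as an unbounded
operator on `L²(X_F)`. -/
def op (B : G.VertexCond S) (W : E → ℝ → ℝ) (F : Finset E) : G.L2 F →ₗ.[ℂ] G.L2 F :=
  (G.opGraph B W F).toLinearPMap

/-- The domain and the action of `H^F` are the ones described by `OpRel`. -/
theorem op_apply_eq_iff {B : G.VertexCond S} {W : E → ℝ → ℝ} {F : Finset E} {f h : G.L2 F} :
    (∃ hf : f ∈ (G.op B W F).domain, G.op B W F ⟨f, hf⟩ = h) ↔ G.OpRel B W F f h := by
  have hg := Submodule.toLinearPMap_graph_eq (G.opGraph B W F)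
    (fun x hx hx' => OpRel.eq_zero hx hx')
  have : G.OpRel B W F f h ↔ (f, h) ∈ (G.op B W F).graph := by
    rw [op, hg]
    rfl
  rw [this, LinearPMap.mem_graph_iff]
  constructor
  · rintro ⟨hf, e⟩
    exact ⟨⟨f, hf⟩, rfl, e⟩
  · rintro ⟨y, rfl, e⟩
    exact ⟨y.2, e⟩

end Operators

/-- A cut-off function on the finite subgraph induced by `E₁`: smooth on the edges, constant on a
neighbourhood of each vertex of the subgraph, zero near its boundary vertices (together with
finiteness of `E₁` this says that the support is compact in the subgraph without its boundary
vertices), equal to `1` on `X_A`, and with derivative supported in `X_{E₃}`. A point `t` of the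
edge of `p` has distance `|t - posAt p|` to the end `p` of that edge. -/
structure IsCutoff {V E : Type*} (G : MetricGraph V E) (E₁ E_A E₃ : Finset E) (φ : E → ℝ → ℂ) :
    Prop where
  smooth : ∀ e ∈ E₁, ContDiffOn ℝ ∞ (φ e) (Ioo 0 (G.l e))
  const_near : ∀ v ∈ G.verts E₁, ∃ c : ℂ, (v ∈ G.bdryVerts E₁ → c = 0) ∧ ∃ r > 0,
    ∀ p : G.Star v, p.1.1 ∈ E₁ → ∀ t ∈ Ioo 0 (G.l p.1.1), |t - G.posAt p.1| < r → φ p.1.1 t = c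
  eq_one : ∀ e ∈ E_A, ∀ t ∈ Ioo 0 (G.l e), φ e t = 1
  deriv_supp : ∀ e ∈ E₁, e ∉ E₃ → ∀ t ∈ Ioo 0 (G.l e), deriv (φ e) t = 0

end MetricGraph
end

/-! Let `f = (H^{E₁} - λ)⁻¹ 1_A g` and let `χ` be a cut-off that is `1` on `X_A` and vanishes at the
boundary vertices of the `E₁`-subgraph. Extended by zero, `χ f` lies in the domain of `H^{E₂}`, and
`(H^{E₂} - λ)(χ f) = 1_A g - k` with `k = χ'' f + 2 χ' f'` (`resOp_cutExtend`). Apply the resolvent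
of `H^{E₂}` and restrict to `X_B`, where `χ f = 0`: this gives `1_B (H^{E₂} - λ)⁻¹ 1_A g = 1_B
(H^{E₂} - λ)⁻¹ k`. Since `k` lives on edges of `E₃ ⊆ E₄`, it remains to bound `‖k‖` by a constant
times `‖1_{E₄} f‖`.

The given `φ` carries no quantitative bound, so only its vertex values are kept, rounded to `0` or
`1` (`IsCutoff.exists_vertex_values`). On each edge `χ` is the cubic interpolating the two end
values with zero slope at both ends. Hence `χ` multiplies all boundary data at a vertex by one
number, which respects the linear vertex conditions (`InDomain.cutExtend`), and its derivatives are
bounded in terms of `l₋` alone.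

The term `χ' f'` is handled one edge at a time. As `E_A` misses `E₄`, there `f'' = (ων - λ) f`, so
`|f''| ≤ M |f|`. Because `χ'` vanishes at the edge ends, the Caccioppoli inequality
`integral_weight_mul_sq_le` produces no vertex terms, and the constant sees neither the vertex
conditions nor `l₊`. -/

noncomputable section

/-! ### Weak derivatives and primitives on an interval -/

/-- Integration by parts for the primitive of an integrable function. -/
theorem integral_deriv_mul_primitive {l : ℝ} {g v v' : ℝ → ℂ}
    (hg : IntegrableOn g (Ioo 0 l)) (hv : ContinuousOn v (Icc 0 l))
    (hd : ∀ t ∈ Ioo 0 l, HasDerivAt v (v' t) t) (hv' : ContinuousOn v' (Icc 0 l)) (h0 : v l = 0) :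
    ∫ t in Ioo 0 l, v' t * ∫ s in 0..t, g s = - ∫ t in Ioo 0 l, v t * g t := by
  have hvi : IntegrableOn v' (Ioo 0 l) :=
    (hv'.integrableOn_compact isCompact_Icc).mono_set Ioo_subset_Icc_self
  -- Fubini for `v'(t) g(s)` on the triangle `s ≤ t`: integrating over `s` first yields the
  -- primitive of `g`, integrating over `t` first yields `v l - v s = -v s`.
  have hprod : Integrable (fun p : ℝ × ℝ => v' p.1 * g p.2)
      ((volume.restrict (Ioo 0 l)).prod (volume.restrict (Ioo 0 l))) := hvi.mul_prod hg
  have hint : Integrable (Function.uncurry fun t s : ℝ => if s ≤ t then v' t * g s else 0)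
      ((volume.restrict (Ioo 0 l)).prod (volume.restrict (Ioo 0 l))) := by
    have := hprod.indicator (measurableSet_le measurable_snd measurable_fst)
    refine this.congr (Filter.Eventually.of_forall fun p => ?_)
    simp [indicator, Function.uncurry]
  have hswap := integral_integral_swap hint
  have e1 : ∀ t ∈ Ioo 0 l, ∫ s in Ioo 0 l, (if s ≤ t then v' t * g s else 0) =
      v' t * ∫ s in 0..t, g s := by
    intro t ht
    rw [intervalIntegral.integral_of_le ht.1.le, ← integral_const_mul,
      ← integral_indicator measurableSet_Ioo, ← integral_indicator measurableSet_Ioc]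
    congr 1
    ext s
    simp only [indicator, mem_Ioo, mem_Ioc]
    have := ht.2
    grind
  have e2 : ∀ s ∈ Ioo 0 l, ∫ t in Ioo 0 l, (if s ≤ t then v' t * g s else 0) = - (v s * g s) := by
    intro s hs
    have f1 : ∫ t in s..l, v' t = v l - v s := by
      refine intervalIntegral.integral_eq_sub_of_hasDerivAt_of_le hs.2.le
        (hv.mono (Icc_subset_Icc_left hs.1.le)) (fun t ht => hd t ⟨hs.1.trans ht.1, ht.2⟩) ?_
      exact (hv'.mono (by rw [uIcc_of_le hs.2.le]; exact Icc_subset_Icc_left hs.1.le)).intervalIntegrable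
    rw [h0, zero_sub] at f1
    rw [← neg_mul, ← f1, intervalIntegral.integral_of_le hs.2.le, ← integral_mul_const,
      ← integral_Icc_eq_integral_Ioc, integral_Icc_eq_integral_Ico,
      ← integral_indicator measurableSet_Ioo, ← integral_indicator measurableSet_Ico]
    congr 1
    ext t
    simp only [indicator, mem_Ioo, mem_Ico]
    have := hs.1
    grind
  rw [setIntegral_congr_fun measurableSet_Ioo e1, setIntegral_congr_fun measurableSet_Ioo e2,
    integral_neg] at hswap
  exact hswap

theorem exists_Icc_of_isCompact_subset_Ioo {l : ℝ} {K : Set ℝ} (hK : IsCompact K)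
    (h : K ⊆ Ioo 0 l) (hl : 0 < l) : ∃ a b, 0 < a ∧ b < l ∧ K ⊆ Icc a b := by
  rcases K.eq_empty_or_nonempty with rfl | hne
  · exact ⟨l / 2, l / 2, by linarith, by linarith, empty_subset _⟩
  · obtain ⟨a, ha, ha'⟩ := hK.exists_isLeast hne
    obtain ⟨b, hb, hb'⟩ := hK.exists_isGreatest hne
    exact ⟨a, b, (h ha).1, (h hb).2, fun x hx => ⟨ha' hx, hb' hx⟩⟩

/-- A test function with vanishing integral is the derivative of a test function. -/
theorem exists_test_primitive {l : ℝ} (hl : 0 < l) {z : ℝ → ℝ} (hz : ContDiff ℝ ∞ z)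
    (hc : HasCompactSupport z) (hs : tsupport z ⊆ Ioo 0 l) (h0 : ∫ t, z t = 0) :
    ∃ η : ℝ → ℝ, ContDiff ℝ ∞ η ∧ HasCompactSupport η ∧ tsupport η ⊆ Ioo 0 l ∧ deriv η = z := by
  obtain ⟨a, b, ha, hb, hab⟩ := exists_Icc_of_isCompact_subset_Ioo hc hs hl
  have hd : ∀ t, HasDerivAt (fun t => ∫ s in 0..t, z s) (z t) t := fun t =>
    intervalIntegral.integral_hasDerivAt_right (hz.continuous.intervalIntegrable _ _)
      (hz.continuous.stronglyMeasurableAtFilter _ _) hz.continuous.continuousAt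
  have hder : deriv (fun t => ∫ s in 0..t, z s) = z := funext fun t => (hd t).deriv
  -- To the left of `a` the integrand is zero; to the right of `b` the primitive equals the total
  -- integral, which is zero by `h0`.
  have hsupp : Function.support (fun t => ∫ s in 0..t, z s) ⊆ Icc a b := by
    intro t ht
    by_contra hcon
    apply ht
    have hz0 : ∀ s, s ∉ Icc a b → z s = 0 := fun s hs' =>
      image_eq_zero_of_notMem_tsupport fun hh => hs' (hab hh)
    simp only [mem_Icc, not_and_or, not_le] at hcon
    rcases hcon with hta | hbt
    · change ∫ s in 0..t, z s = 0
      refine intervalIntegral.integral_zero_ae (Filter.Eventually.of_forall fun s hs' => ?_)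
      apply hz0
      rw [mem_uIoc] at hs'
      intro hh
      have := hh.1
      rcases hs' with hs' | hs' <;> linarith [hs'.1, hs'.2]
    · change ∫ s in 0..t, z s = 0
      rw [intervalIntegral.integral_eq_integral_of_support_subset, h0]
      intro s hs'
      have := hab (subset_tsupport _ hs')
      exact ⟨by linarith [this.1], by linarith [this.2]⟩
  have hts : tsupport (fun t => ∫ s in 0..t, z s) ⊆ Icc a b := closure_minimal hsupp isClosed_Icc
  refine ⟨fun t => ∫ s in 0..t, z s, ?_, ?_, hts.trans fun t ht =>
    ⟨ha.trans_le ht.1, ht.2.trans_lt hb⟩, hder⟩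
  · rw [contDiff_infty_iff_deriv, hder]
    exact ⟨fun t => (hd t).differentiableAt, hz⟩
  · exact isCompact_Icc.of_isClosed_subset (isClosed_tsupport _) hts

/-- The lemma of du Bois-Reymond: a function with zero weak derivative is constant. -/
theorem ae_const_of_integral_deriv_smul_eq_zero {l : ℝ} (hl : 0 < l) {f : ℝ → ℂ}
    (hf : IntegrableOn f (Ioo 0 l))
    (h : ∀ η : ℝ → ℝ, ContDiff ℝ ∞ η → HasCompactSupport η → tsupport η ⊆ Ioo 0 l →
      ∫ t in Ioo 0 l, deriv η t • f t = 0) :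
    ∃ c : ℂ, ∀ᵐ t ∂(volume.restrict (Ioo 0 l)), f t = c := by
  let φ : ContDiffBump (l / 2) := ⟨l / 8, l / 4, by linarith, by linarith⟩
  set ρ : ℝ → ℝ := φ.normed volume with hρ
  have ρs : ContDiff ℝ ∞ ρ := φ.contDiff_normed
  have ρc : HasCompactSupport ρ := φ.hasCompactSupport_normed
  have ρt : tsupport ρ ⊆ Ioo 0 l := by
    rw [hρ, φ.tsupport_normed_eq, Real.closedBall_eq_Icc]
    intro t ht
    have h1 : l / 2 - l / 4 ≤ t := ht.1
    have h2 : t ≤ l / 2 + l / 4 := ht.2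
    exact ⟨by linarith, by linarith⟩
  have ρi : ∫ t, ρ t = 1 := φ.integral_normed
  have hsm : ∀ η : ℝ → ℝ, Continuous η → HasCompactSupport η →
      IntegrableOn (fun t => η t • f t) (Ioo 0 l) := fun η hη hη' => by
    obtain ⟨C, hC⟩ := hη'.exists_bound_of_continuous hη
    exact hf.bdd_smul C hη.aestronglyMeasurable (Filter.Eventually.of_forall hC)
  -- The constant is the mean of `f` against a bump of mass one. For a test function `η` of mass
  -- `m`, `η - m ρ` has mean zero and so is the derivative of a test function; testing with it shows
  -- `∫ η f = m c`.
  refine ⟨∫ t in Ioo 0 l, ρ t • f t, ?_⟩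
  set c := ∫ t in Ioo 0 l, ρ t • f t with hcdef
  have key := isOpen_Ioo.ae_eq_zero_of_integral_contDiff_smul_eq_zero (μ := volume)
    (f := fun t => f t - c) (U := Ioo (0 : ℝ) l)
    (IntegrableOn.locallyIntegrableOn (hf.sub (integrableOn_const (by simp)))) (by
      intro η h1 h2 h3
      set m := ∫ t, η t with hm
      have zc : HasCompactSupport (fun t => η t - m * ρ t) :=
        h2.sub (ρc.mul_left (f := fun _ => m))
      have zs : tsupport (fun t => η t - m * ρ t) ⊆ Ioo 0 l := by
        refine (tsupport_sub η fun t => m * ρ t).trans (union_subset h3 ?_)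
        exact (tsupport_mul_subset_right (f := fun _ => m)).trans ρt
      obtain ⟨θ, t1, t2, t3, t4⟩ := exists_test_primitive hl (z := fun t => η t - m * ρ t)
        (h1.sub (contDiff_const.mul ρs)) zc zs (by
          rw [integral_sub (h1.continuous.integrable_of_hasCompactSupport h2)
            ((ρs.continuous.integrable_of_hasCompactSupport ρc).const_mul m), integral_const_mul,
            ρi, mul_one, ← hm, sub_self])
      have h4 := h θ t1 t2 t3
      rw [t4] at h4
      have h5 : ∫ t in Ioo 0 l, (η t - m * ρ t) • f t = (∫ t in Ioo 0 l, η t • f t) - m • c := by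
        have i3 : IntegrableOn (fun t => m • ρ t • f t) (Ioo 0 l) :=
          (hsm ρ ρs.continuous ρc).smul m
        rw [hcdef, ← integral_smul, ← integral_sub (hsm η h1.continuous h2) i3]
        congr 1
        ext t
        rw [sub_smul, mul_smul]
      have h6 : ∫ t in Ioo 0 l, η t • c = m • c := by
        rw [integral_smul_const, hm, setIntegral_eq_integral_of_forall_compl_eq_zero]
        exact fun t ht => image_eq_zero_of_notMem_tsupport fun hh => ht (h3 hh)
      rw [← setIntegral_eq_integral_of_forall_compl_eq_zero (s := Ioo 0 l) fun t ht => by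
        rw [image_eq_zero_of_notMem_tsupport (fun hh => ht (h3 hh)), zero_smul]]
      simp_rw [smul_sub]
      rw [integral_sub (hsm η h1.continuous h2)
        ((h1.continuous.integrable_of_hasCompactSupport h2).integrableOn.smul_const c), h6, ← h5, h4])
  filter_upwards [(ae_restrict_iff' (measurableSet_Ioo (a := (0 : ℝ)) (b := l))).2 key] with t ht
  exact sub_eq_zero.1 ht

theorem L2Interval.integrable {l : ℝ} (f : L2Interval l) :
    Integrable f (volume.restrict (Ioo (0 : ℝ) l)) :=
  (Lp.memLp f).integrable (by norm_num)

theorem continuousOn_primitive_Icc {l : ℝ} (hl : 0 < l) {g : ℝ → ℂ}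
    (hg : IntegrableOn g (Ioo 0 l)) : ContinuousOn (fun t => ∫ s in 0..t, g s) (Icc 0 l) := by
  have := intervalIntegral.continuousOn_primitive_interval (μ := volume) (f := g) (a := 0) (b := l)
    (by rw [uIcc_of_le hl.le, integrableOn_Icc_iff_integrableOn_Ioo]; exact hg)
  rwa [uIcc_of_le hl.le] at this

/-- The continuous representative of a function is a primitive of its weak derivative. -/
theorem HasWeakDeriv.contRep_eq {l : ℝ} (hl : 0 < l) {f g : L2Interval l} {u : ℝ → ℂ}
    (h : HasWeakDeriv f g) (hu : IsContRep f u) :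
    ∀ t ∈ Icc 0 l, u t = u 0 + ∫ s in 0..t, g s := by
  have hG := continuousOn_primitive_Icc hl g.integrable
  have hGi : IntegrableOn (fun t => ∫ s in 0..t, g s) (Ioo 0 l) :=
    (hG.integrableOn_compact isCompact_Icc).mono_set Ioo_subset_Icc_self
  obtain ⟨c, hc⟩ := ae_const_of_integral_deriv_smul_eq_zero hl
    (f := fun t => f t - ∫ s in 0..t, g s) (f.integrable.sub hGi) (by
      intro η h1 h2 h3
      have hd : Continuous (deriv η) := h1.continuous_deriv (by simp)
      have hη0 : η l = 0 := image_eq_zero_of_notMem_tsupport fun hh => (h3 hh).2.ne rfl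
      obtain ⟨C, hC⟩ := h2.deriv.exists_bound_of_continuous hd
      have i2 : IntegrableOn (fun t => deriv η t • ∫ s in 0..t, g s) (Ioo 0 l) :=
        Integrable.bdd_smul hGi C hd.aestronglyMeasurable (Filter.Eventually.of_forall hC)
      simp_rw [smul_sub]
      rw [integral_sub (integrable_test_smul f hd h2.deriv) i2, h η h1 h2 h3]
      have := integral_deriv_mul_primitive (l := l) (g := g) (v := fun t => (η t : ℂ))
        (v' := fun t => ((deriv η t : ℝ) : ℂ)) g.integrable
        (Complex.continuous_ofReal.comp h1.continuous).continuousOn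
        (fun t _ => ((h1.differentiable (by simp) t).hasDerivAt).ofReal_comp)
        (Complex.continuous_ofReal.comp hd).continuousOn (by simp [hη0])
      simp only [Complex.real_smul]
      rw [this, sub_self])
  -- Two continuous functions equal almost everywhere on a nondegenerate interval are equal on it;
  -- evaluation at `0` then identifies `c` with `u 0`.
  have hae : u =ᵐ[volume.restrict (Icc 0 l)] fun t => c + ∫ s in 0..t, g s := by
    rw [← Measure.restrict_congr_set (Ioo_ae_eq_Icc (α := ℝ) (μ := volume) (a := 0) (b := l))]
    filter_upwards [hc, hu.2] with t h1 h2
    rw [← h2, ← h1]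
    ring
  have heq := Measure.eqOn_Icc_of_ae_eq volume hl.ne hae hu.1 (continuousOn_const.add hG)
  have h0 := heq (left_mem_Icc.2 hl.le)
  simp only [intervalIntegral.integral_same, add_zero] at h0
  intro t ht
  rw [h0]
  exact heq ht

/-- If the weak derivative is continuous, it is the classical derivative. -/
theorem HasWeakDeriv.hasDerivAt_contRep {l : ℝ} {f g : L2Interval l} {u u₁ : ℝ → ℂ}
    (h : HasWeakDeriv f g) (hu : IsContRep f u) (hu₁ : IsContRep g u₁) {t : ℝ}
    (ht : t ∈ Ioo 0 l) : HasDerivAt u (u₁ t) t := by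
  have hl := ht.1.trans ht.2
  have hrep := h.contRep_eq hl hu
  have hev : u =ᶠ[nhds t] fun t => u 0 + ∫ s in 0..t, u₁ s := by
    filter_upwards [isOpen_Ioo.mem_nhds ht] with x hx
    rw [hrep x (Ioo_subset_Icc_self hx)]
    congr 1
    refine intervalIntegral.integral_congr_ae_restrict ?_
    rw [uIoc_of_le hx.1.le]
    refine ae_restrict_of_ae_restrict_of_subset ?_ hu₁.2
    exact fun y hy => ⟨hy.1, hy.2.trans_lt hx.2⟩
  refine HasDerivAt.congr_of_eventuallyEq ?_ hev
  refine HasDerivAt.const_add _ (intervalIntegral.integral_hasDerivAt_right ?_ ?_ ?_)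
  · refine (hu₁.1.mono ?_).intervalIntegrable
    rw [uIcc_of_le ht.1.le]
    exact Icc_subset_Icc_right ht.2.le
  · exact (hu₁.1.mono Ioo_subset_Icc_self).stronglyMeasurableAtFilter isOpen_Ioo t ht
  · exact hu₁.1.continuousAt (Icc_mem_nhds ht.1 ht.2)

/-- Integration by parts against a weakly differentiable function. -/
theorem HasWeakDeriv.integral_deriv_mul {l : ℝ} (hl : 0 < l) {f g : L2Interval l} {u v v' : ℝ → ℂ}
    (h : HasWeakDeriv f g) (hu : IsContRep f u) (hv : ContinuousOn v (Icc 0 l))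
    (hd : ∀ t ∈ Ioo 0 l, HasDerivAt v (v' t) t) (hv' : ContinuousOn v' (Icc 0 l))
    (h0 : v 0 = 0) (h1 : v l = 0) :
    ∫ t in Ioo 0 l, v' t * u t = - ∫ t in Ioo 0 l, v t * g t := by
  have hG := continuousOn_primitive_Icc hl g.integrable
  have hi : ∀ {w : ℝ → ℂ}, ContinuousOn w (Icc 0 l) → IntegrableOn w (Ioo 0 l) := fun hw =>
    (hw.integrableOn_compact isCompact_Icc).mono_set Ioo_subset_Icc_self
  have i2 : IntegrableOn (fun t => v' t * ∫ s in 0..t, g s) (Ioo 0 l) := hi (hv'.mul hG)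
  -- The constant part `u 0` contributes `u 0 * ∫ v'`, which is zero since `v` vanishes at both
  -- ends.
  rw [setIntegral_congr_fun (g := fun t => v' t * u 0 + v' t * ∫ s in 0..t, g s) measurableSet_Ioo
    fun t ht => by
      change v' t * u t = v' t * u 0 + v' t * ∫ s in 0..t, g s
      rw [h.contRep_eq hl hu t (Ioo_subset_Icc_self ht), mul_add],
    integral_add ((hi hv').mul_const _) i2,
    integral_deriv_mul_primitive g.integrable hv hd hv' h1, integral_mul_const]
  have : ∫ t in 0..l, v' t = v l - v 0 :=
    intervalIntegral.integral_eq_sub_of_hasDerivAt_of_le hl.le hv hd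
      (hv'.mono (by rw [uIcc_of_le hl.le])).intervalIntegrable
  rw [intervalIntegral.integral_of_le hl.le, integral_Ioc_eq_integral_Ioo, h0, h1, sub_zero] at this
  rw [this, zero_mul, zero_add]

/-! ### Norms in `L²(0, l)` and the weighted derivative estimate -/

theorem L2Interval.norm_sq_eq {l : ℝ} (f : L2Interval l) :
    ‖f‖ ^ 2 = ∫ t in Ioo 0 l, ‖f t‖ ^ 2 := by
  have h := @inner_self_eq_norm_sq ℂ _ _ _ _ f
  rw [L2.inner_def, ← integral_re (L2.integrable_inner f f)] at h
  rw [← h]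
  simp only [inner_self_eq_norm_sq]

theorem L2Interval.integrable_norm_sq {l : ℝ} (f : L2Interval l) :
    IntegrableOn (fun t => ‖f t‖ ^ 2) (Ioo 0 l) :=
  (memLp_two_iff_integrable_sq_norm (Lp.memLp f).1).1 (Lp.memLp f)

/-- A weighted Caccioppoli inequality: if `|f''| ≤ M |f|` then a weight vanishing at the end points
of the interval controls the derivative. -/
theorem integral_weight_mul_sq_le {l M K : ℝ} (hl : 0 < l) {f f₁ f₂ : L2Interval l}
    {u u₁ : ℝ → ℂ} (h : HasWeakDeriv f f₁) (h' : HasWeakDeriv f₁ f₂) (hu : IsContRep f u)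
    (hu₁ : IsContRep f₁ u₁) (hM : ∀ᵐ t ∂(volume.restrict (Ioo 0 l)), ‖f₂ t‖ ≤ M * ‖f t‖)
    {w w' : ℝ → ℝ} (hw : ∀ t, HasDerivAt w (w' t) t) (hw' : Continuous w') (h0 : w 0 = 0)
    (h1 : w l = 0) (hK : ∀ t ∈ Icc 0 l, 4 * w' t ^ 2 + 2 * M * w t ^ 2 ≤ K) :
    ∫ t in Ioo 0 l, w t ^ 2 * ‖f₁ t‖ ^ 2 ≤ K * ∫ t in Ioo 0 l, ‖f t‖ ^ 2 := by
  have hwc : Continuous w := continuous_iff_continuousAt.2 fun t => (hw t).continuousAt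
  have wC : Continuous fun t => (w t : ℂ) := Complex.continuous_ofReal.comp hwc
  have wC' : Continuous fun t => (w' t : ℂ) := Complex.continuous_ofReal.comp hw'
  have uC : ContinuousOn (fun t => starRingEnd ℂ (u t)) (Icc 0 l) :=
    Complex.continuous_conj.comp_continuousOn hu.1
  have uC₁ : ContinuousOn (fun t => starRingEnd ℂ (u₁ t)) (Icc 0 l) :=
    Complex.continuous_conj.comp_continuousOn hu₁.1
  -- The Caccioppoli test function `w² ū`: it vanishes at both ends with `w`, and `v' u₁` contains
  -- the term `w² |f'|²` to be estimated.
  set v : ℝ → ℂ := fun t => (w t : ℂ) ^ 2 * starRingEnd ℂ (u t) with hv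
  set v' : ℝ → ℂ := fun t => 2 * (w t : ℂ) * w' t * starRingEnd ℂ (u t) +
    (w t : ℂ) ^ 2 * starRingEnd ℂ (u₁ t) with hv'
  have vc : ContinuousOn v (Icc 0 l) := ((wC.pow 2).continuousOn).mul uC
  have vc' : ContinuousOn v' (Icc 0 l) :=
    (((continuous_const.mul wC).mul wC').continuousOn.mul uC).add
      (((wC.pow 2).continuousOn).mul uC₁)
  have hd : ∀ t ∈ Ioo 0 l, HasDerivAt v (v' t) t := by
    intro t ht
    have d1 : HasDerivAt (fun t => starRingEnd ℂ (u t)) (starRingEnd ℂ (u₁ t)) t :=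
      (h.hasDerivAt_contRep hu hu₁ ht).star
    have d2 := ((hw t).ofReal_comp.pow 2).mul d1
    refine d2.congr_deriv ?_
    simp only [hv', Pi.pow_apply]
    push_cast
    ring
  have hibp := h'.integral_deriv_mul hl hu₁ vc hd vc' (by simp [hv, h0]) (by simp [hv, h1])
  have i1 : IntegrableOn (fun t => v' t * u₁ t) (Ioo 0 l) :=
    ((vc'.mul hu₁.1).integrableOn_compact isCompact_Icc).mono_set Ioo_subset_Icc_self
  have i2 : IntegrableOn (fun t => v t * f₂ t) (Ioo 0 l) := by
    obtain ⟨C, hC⟩ := isCompact_Icc.exists_bound_of_continuousOn vc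
    refine Integrable.bdd_mul (c := C) f₂.integrable
      ((vc.mono Ioo_subset_Icc_self).aestronglyMeasurable measurableSet_Ioo) ?_
    filter_upwards [ae_restrict_mem measurableSet_Ioo] with t ht
    exact hC t (Ioo_subset_Icc_self ht)
  have hre : ∫ t in Ioo 0 l, (v' t * u₁ t + v t * f₂ t).re = 0 := by
    have := integral_re (i1.add i2)
    simp only [Pi.add_apply, RCLike.re_eq_complex_re] at this
    rw [this, integral_add i1 i2, hibp, neg_add_cancel, Complex.zero_re]
  have i3 : IntegrableOn (fun t => w t ^ 2 * ‖f₁ t‖ ^ 2) (Ioo 0 l) := by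
    obtain ⟨C, hC⟩ := isCompact_Icc.exists_bound_of_continuousOn (s := Icc 0 l)
      (hwc.pow 2).continuousOn
    refine Integrable.bdd_mul (c := C) f₁.integrable_norm_sq (hwc.pow 2).aestronglyMeasurable ?_
    filter_upwards [ae_restrict_mem measurableSet_Ioo] with t ht
    exact hC t (Ioo_subset_Icc_self ht)
  have i4 : IntegrableOn (fun t => K * ‖f t‖ ^ 2) (Ioo 0 l) := f.integrable_norm_sq.const_mul K
  -- The factor `2` leaves one copy of `w² |f'|²` after another has absorbed the cross term. With `A
  -- = |w| |f'|` and `B = |w'| |f|`, the integrand on the right is at least `2A² - 4AB - 2M w²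
  -- |f|²`, and `4AB ≤ A² + 4B²`; this is the origin of the condition on `K`.
  have hle : ∫ t in Ioo 0 l, (w t ^ 2 * ‖f₁ t‖ ^ 2 - K * ‖f t‖ ^ 2) ≤
      ∫ t in Ioo 0 l, 2 * (v' t * u₁ t + v t * f₂ t).re := by
    refine integral_mono_ae (i3.sub i4) ((i1.add i2).re.const_mul 2) ?_
    filter_upwards [hM, hu.2, hu₁.2, ae_restrict_mem measurableSet_Ioo] with t m1 m2 m3 m4
    have k := hK t (Ioo_subset_Icc_self m4)
    rw [m2] at m1 ⊢
    rw [m3]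
    have e1 : (v' t * u₁ t + v t * f₂ t).re = 2 * w t * w' t * (starRingEnd ℂ (u t) * u₁ t).re +
        w t ^ 2 * ‖u₁ t‖ ^ 2 + w t ^ 2 * (starRingEnd ℂ (u t) * f₂ t).re := by
      have : v' t * u₁ t + v t * f₂ t =
          ((2 * w t * w' t : ℝ) : ℂ) * (starRingEnd ℂ (u t) * u₁ t) +
          ((w t ^ 2 * ‖u₁ t‖ ^ 2 : ℝ) : ℂ) +
          ((w t ^ 2 : ℝ) : ℂ) * (starRingEnd ℂ (u t) * f₂ t) := by
        simp only [hv, hv']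
        push_cast
        rw [← Complex.conj_mul']
        ring
      rw [this]
      simp only [Complex.add_re, Complex.re_ofReal_mul, Complex.ofReal_re]
    have b1 : |(starRingEnd ℂ (u t) * u₁ t).re| ≤ ‖u t‖ * ‖u₁ t‖ := by
      refine (Complex.abs_re_le_norm _).trans ?_
      rw [norm_mul, RCLike.norm_conj]
    have b2 : |(starRingEnd ℂ (u t) * f₂ t).re| ≤ ‖u t‖ * (M * ‖u t‖) := by
      refine (Complex.abs_re_le_norm _).trans ?_
      rw [norm_mul, RCLike.norm_conj]
      exact mul_le_mul_of_nonneg_left m1 (norm_nonneg _)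
    simp only [e1]
    have c1 : -(|w t| * ‖u₁ t‖ * (|w' t| * ‖u t‖)) ≤
        w t * w' t * (starRingEnd ℂ (u t) * u₁ t).re := by
      have := neg_abs_le (w t * w' t * (starRingEnd ℂ (u t) * u₁ t).re)
      rw [abs_mul, abs_mul] at this
      have := mul_le_mul_of_nonneg_left b1 (mul_nonneg (abs_nonneg (w t)) (abs_nonneg (w' t)))
      linarith
    have c2 : -(w t ^ 2 * (‖u t‖ * (M * ‖u t‖))) ≤
        w t ^ 2 * (starRingEnd ℂ (u t) * f₂ t).re := by
      have := mul_le_mul_of_nonneg_left (neg_le_of_abs_le b2) (sq_nonneg (w t))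
      linarith
    have c3 := mul_le_mul_of_nonneg_right k (sq_nonneg ‖u t‖)
    have c4 := sq_nonneg (|w t| * ‖u₁ t‖ - 2 * (|w' t| * ‖u t‖))
    have c5 : (|w t| * ‖u₁ t‖) ^ 2 = w t ^ 2 * ‖u₁ t‖ ^ 2 := by rw [mul_pow, sq_abs]
    have c6 : (|w' t| * ‖u t‖) ^ 2 = w' t ^ 2 * ‖u t‖ ^ 2 := by rw [mul_pow, sq_abs]
    nlinarith
  rw [integral_const_mul, hre, mul_zero, integral_sub i3 i4, integral_const_mul] at hle
  linarith

/-! ### Multiplication by smooth functions -/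

theorem L2Interval.memLp_smul {l : ℝ} {ψ : ℝ → ℝ} (hψ : Continuous ψ) (f : L2Interval l) :
    MemLp (fun t => ψ t • f t) 2 (volume.restrict (Ioo 0 l)) := by
  obtain ⟨C, hC⟩ := isCompact_Icc.exists_bound_of_continuousOn (s := Icc 0 l) hψ.continuousOn
  refine (Lp.memLp f).of_le_mul (c := C) (hψ.aestronglyMeasurable.smul (Lp.aestronglyMeasurable f)) ?_
  filter_upwards [ae_restrict_mem measurableSet_Ioo] with t ht
  rw [norm_smul]
  exact mul_le_mul_of_nonneg_right (hC t (Ioo_subset_Icc_self ht)) (norm_nonneg _)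

/-- The product of a continuous function and an `L²` function on a bounded interval. -/
def L2Interval.contSMul {l : ℝ} (ψ : ℝ → ℝ) (hψ : Continuous ψ) (f : L2Interval l) :
    L2Interval l :=
  (f.memLp_smul hψ).toLp _

theorem L2Interval.coeFn_contSMul {l : ℝ} {ψ : ℝ → ℝ} (hψ : Continuous ψ) (f : L2Interval l) :
    ∀ᵐ t ∂(volume.restrict (Ioo 0 l)), f.contSMul ψ hψ t = ψ t • f t :=
  (f.memLp_smul hψ).coeFn_toLp

theorem IsContRep.contSMul {l : ℝ} {ψ : ℝ → ℝ} (hψ : Continuous ψ) {f : L2Interval l}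
    {u : ℝ → ℂ} (hu : IsContRep f u) :
    IsContRep (f.contSMul ψ hψ) (fun t => ψ t • u t) := by
  refine ⟨hψ.continuousOn.smul hu.1, ?_⟩
  filter_upwards [f.coeFn_contSMul hψ, hu.2] with t h1 h2
  rw [h1, h2]

/-- The product rule. -/
theorem HasWeakDeriv.contSMul {l : ℝ} {ψ ψ' : ℝ → ℝ} (hψ : ContDiff ℝ ∞ ψ) (hψ' : Continuous ψ')
    (hd : ∀ t, HasDerivAt ψ (ψ' t) t) {f g : L2Interval l} (h : HasWeakDeriv f g) :
    HasWeakDeriv (f.contSMul ψ hψ.continuous)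
      (f.contSMul ψ' hψ' + g.contSMul ψ hψ.continuous) := by
  intro η h1 h2 h3
  have hηd : Continuous (deriv η) := h1.continuous_deriv (by simp)
  -- The smooth factor is moved onto the test function: `η ψ` is again admissible for `f`.
  have hder : deriv (fun t => η t * ψ t) = fun t => deriv η t * ψ t + η t * ψ' t :=
    funext fun t => ((h1.differentiable (by simp) t).hasDerivAt.mul (hd t)).deriv
  have key := h (fun t => η t * ψ t) (h1.mul hψ) h2.mul_right
    ((tsupport_mul_subset_left (f := η) (g := ψ)).trans h3)
  rw [hder] at key
  have i1 : Integrable (fun t => (deriv η t * ψ t) • f t) (volume.restrict (Ioo 0 l)) :=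
    integrable_test_smul f (hηd.mul hψ.continuous) h2.deriv.mul_right
  have i2 : Integrable (fun t => (η t * ψ' t) • f t) (volume.restrict (Ioo 0 l)) :=
    integrable_test_smul f (h1.continuous.mul hψ') h2.mul_right
  have i3 : Integrable (fun t => (η t * ψ t) • g t) (volume.restrict (Ioo 0 l)) :=
    integrable_test_smul g (h1.continuous.mul hψ.continuous) h2.mul_right
  simp only [add_smul] at key
  rw [integral_add i1 i2] at key
  have e1 : ∫ t in Ioo 0 l, deriv η t • f.contSMul ψ hψ.continuous t =
      ∫ t in Ioo 0 l, (deriv η t * ψ t) • f t := by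
    refine integral_congr_ae ?_
    filter_upwards [f.coeFn_contSMul hψ.continuous] with t ht
    rw [ht, mul_smul]
  have e2 : ∫ t in Ioo 0 l, η t • (f.contSMul ψ' hψ' + g.contSMul ψ hψ.continuous :
      L2Interval l) t = ∫ t in Ioo 0 l, ((η t * ψ' t) • f t + (η t * ψ t) • g t) := by
    refine integral_congr_ae ?_
    filter_upwards [f.coeFn_contSMul hψ', g.coeFn_contSMul hψ.continuous,
      Lp.coeFn_add (f.contSMul ψ' hψ') (g.contSMul ψ hψ.continuous)] with t a1 a2 a3
    rw [a3, Pi.add_apply, a1, a2, smul_add, mul_smul, mul_smul]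
  rw [e1, e2, integral_add i2 i3]
  linear_combination key

theorem HasWeakDeriv.zero (l : ℝ) : HasWeakDeriv (0 : L2Interval l) 0 := by
  intro η _ _ _
  have h5 : ∀ η' : ℝ → ℝ, ∫ t in Ioo 0 l, η' t • (0 : L2Interval l) t = 0 := by
    intro η'
    rw [integral_eq_zero_of_ae]
    filter_upwards [Lp.coeFn_zero ℂ 2 (volume.restrict (Ioo (0 : ℝ) l))] with t ht
    rw [ht]
    simp
  rw [h5, h5, neg_zero]

theorem IsContRep.zero (l : ℝ) : IsContRep (0 : L2Interval l) fun _ => 0 :=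
  ⟨continuousOn_const, Lp.coeFn_zero ℂ 2 _⟩

theorem L2Interval.contSMul_zero {l : ℝ} {ψ : ℝ → ℝ} (hψ : Continuous ψ) (h0 : ∀ t, ψ t = 0)
    (f : L2Interval l) : f.contSMul ψ hψ = 0 := by
  apply Lp.ext
  filter_upwards [f.coeFn_contSMul hψ, Lp.coeFn_zero ℂ 2 (volume.restrict (Ioo (0 : ℝ) l))]
    with t h1 h2
  rw [h1, h2, h0, zero_smul]
  rfl

/-! ### The cut-off function on an edge -/

/-- A smooth function on `[0, l]` with value `a` at `0`, value `b` at `l`, and derivative zero at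
both ends. -/
def edgeCutoff (l a b t : ℝ) : ℝ := a + (b - a) * (3 * (t / l) ^ 2 - 2 * (t / l) ^ 3)

/-- The profile of the derivative of `edgeCutoff`. -/
def edgeWeight (l t : ℝ) : ℝ := 6 * t * (l - t) / l ^ 3

/-- The profile of the second derivative of `edgeCutoff`. -/
def edgeWeight' (l t : ℝ) : ℝ := 6 * (l - 2 * t) / l ^ 3

theorem contDiff_edgeCutoff (l a b : ℝ) : ContDiff ℝ ∞ (edgeCutoff l a b) := by
  unfold edgeCutoff
  fun_prop

theorem contDiff_edgeWeight (l : ℝ) : ContDiff ℝ ∞ (edgeWeight l) := by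
  unfold edgeWeight
  fun_prop

theorem continuous_edgeWeight' (l : ℝ) : Continuous (edgeWeight' l) := by
  unfold edgeWeight'
  fun_prop

theorem hasDerivAt_edgeCutoff {l : ℝ} (hl : 0 < l) (a b t : ℝ) :
    HasDerivAt (edgeCutoff l a b) ((b - a) * edgeWeight l t) t := by
  have h := (hasDerivAt_id t).div_const l
  have := ((((h.pow 2).const_mul 3).sub ((h.pow 3).const_mul 2)).const_mul (b - a)).const_add a
  refine this.congr_deriv ?_
  simp only [edgeWeight, id_eq, Nat.add_one_sub_one, Nat.cast_ofNat, pow_one]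
  field_simp
  ring

theorem hasDerivAt_edgeWeight (l t : ℝ) : HasDerivAt (edgeWeight l) (edgeWeight' l t) t := by
  have h := (((hasDerivAt_id t).const_mul 6).mul ((hasDerivAt_id t).const_sub l)).div_const (l ^ 3)
  refine h.congr_deriv ?_
  simp only [edgeWeight', id_eq]
  ring

/-- The profile scales like `1 / l`, so a lower bound on the edge length suffices; the second
profile below scales like `1 / l²`. -/
theorem sq_edgeWeight_le {l m t : ℝ} (hm : 0 < m) (hml : m ≤ l) (ht : t ∈ Icc 0 l) :
    edgeWeight l t ^ 2 ≤ 36 / m ^ 2 := by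
  have hl := hm.trans_le hml
  have h1 : 0 ≤ edgeWeight l t :=
    div_nonneg (mul_nonneg (mul_nonneg (by norm_num) ht.1) (sub_nonneg.2 ht.2)) (by positivity)
  have h2 : edgeWeight l t ≤ 6 / m := by
    rw [edgeWeight, div_le_div_iff₀ (by positivity) hm]
    have a1 : t * (l - t) ≤ l * l :=
      mul_le_mul ht.2 (by linarith [ht.1]) (sub_nonneg.2 ht.2) hl.le
    have a2 : t * (l - t) * m ≤ l * l * l := mul_le_mul a1 hml hm.le (by positivity)
    nlinarith
  calc edgeWeight l t ^ 2 ≤ (6 / m) ^ 2 := pow_le_pow_left₀ h1 h2 2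
    _ = 36 / m ^ 2 := by rw [div_pow]; norm_num

theorem sq_edgeWeight'_le {l m t : ℝ} (hm : 0 < m) (hml : m ≤ l) (ht : t ∈ Icc 0 l) :
    edgeWeight' l t ^ 2 ≤ 36 / m ^ 4 := by
  have hl := hm.trans_le hml
  have h1 : |edgeWeight' l t| ≤ 6 / m ^ 2 := by
    rw [edgeWeight', abs_div, abs_of_pos (a := l ^ 3) (by positivity),
      div_le_div_iff₀ (by positivity) (by positivity), abs_mul, abs_of_pos (a := (6 : ℝ)) (by norm_num)]
    have a1 : |l - 2 * t| ≤ l := abs_le.2 ⟨by linarith [ht.2], by linarith [ht.1]⟩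
    have a2 : |l - 2 * t| * m ^ 2 ≤ l * l ^ 2 :=
      mul_le_mul a1 (pow_le_pow_left₀ hm.le hml 2) (by positivity) hl.le
    nlinarith
  calc edgeWeight' l t ^ 2 = |edgeWeight' l t| ^ 2 := (sq_abs _).symm
    _ ≤ (6 / m ^ 2) ^ 2 := pow_le_pow_left₀ (abs_nonneg _) h1 2
    _ = 36 / m ^ 4 := by rw [div_pow, ← pow_mul]; norm_num

section EdgeCutoff

variable {l : ℝ} (a b : ℝ)

/-- The product of the cut-off function with `f`. -/
def cutMul (f : L2Interval l) : L2Interval l :=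
  f.contSMul (edgeCutoff l a b) (contDiff_edgeCutoff l a b).continuous

/-- The product of the derivative of the cut-off function with `f`. -/
def cutMul' (f : L2Interval l) : L2Interval l :=
  f.contSMul (fun t => (b - a) * edgeWeight l t)
    (continuous_const.mul (contDiff_edgeWeight l).continuous)

/-- The product of the second derivative of the cut-off function with `f`. -/
def cutMul'' (f : L2Interval l) : L2Interval l :=
  f.contSMul (fun t => (b - a) * edgeWeight' l t)
    (continuous_const.mul (continuous_edgeWeight' l))

theorem coeFn_cutMul (f : L2Interval l) : ∀ᵐ t ∂(volume.restrict (Ioo 0 l)),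
    cutMul a b f t = edgeCutoff l a b t • f t :=
  f.coeFn_contSMul _

theorem coeFn_cutMul' (f : L2Interval l) : ∀ᵐ t ∂(volume.restrict (Ioo 0 l)),
    cutMul' a b f t = ((b - a) * edgeWeight l t) • f t :=
  f.coeFn_contSMul _

theorem coeFn_cutMul'' (f : L2Interval l) : ∀ᵐ t ∂(volume.restrict (Ioo 0 l)),
    cutMul'' a b f t = ((b - a) * edgeWeight' l t) • f t :=
  f.coeFn_contSMul _

variable {a b} {f f₁ f₂ : L2Interval l}

theorem HasWeakDeriv.cutMul (hl : 0 < l) (h : HasWeakDeriv f f₁) :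
    HasWeakDeriv (cutMul a b f) (cutMul' a b f + cutMul a b f₁) :=
  h.contSMul (contDiff_edgeCutoff l a b) _ (hasDerivAt_edgeCutoff hl a b)

theorem HasWeakDeriv.cutMul' (h : HasWeakDeriv f f₁) :
    HasWeakDeriv (cutMul' a b f) (cutMul'' a b f + cutMul' a b f₁) :=
  h.contSMul (contDiff_const.mul (contDiff_edgeWeight l)) _
    fun t => (hasDerivAt_edgeWeight l t).const_mul _

/-- Equal end values make the cut-off constant on the edge; this and its companion confine the
commutator to edges with differing end values. -/
theorem cutMul'_self : cutMul' a a f = 0 := L2Interval.contSMul_zero _ (by simp) f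

theorem cutMul''_self : cutMul'' a a f = 0 := L2Interval.contSMul_zero _ (by simp) f

/-- The commutator of `-d²/dx²` with the cut-off function, applied to a solution, is bounded in
terms of the solution. -/
theorem norm_commutator_sq_le {m M : ℝ} (hm : 0 < m) (hml : m ≤ l) (hM0 : 0 ≤ M)
    (hab : (b - a) ^ 2 ≤ 1) (h : HasWeakDeriv f f₁) (h' : HasWeakDeriv f₁ f₂) {u u₁ : ℝ → ℂ}
    (hu : IsContRep f u) (hu₁ : IsContRep f₁ u₁)
    (hM : ∀ᵐ t ∂(volume.restrict (Ioo 0 l)), ‖f₂ t‖ ≤ M * ‖f t‖) :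
    ‖cutMul'' a b f + (2 : ℂ) • cutMul' a b f₁‖ ^ 2 ≤
      (2 * (36 / m ^ 4) + 8 * (4 * (36 / m ^ 4) + 2 * M * (36 / m ^ 2))) * ‖f‖ ^ 2 := by
  have hl := hm.trans_le hml
  have i0 := f.integrable_norm_sq
  have n1 : ‖cutMul'' a b f‖ ^ 2 ≤ 36 / m ^ 4 * ‖f‖ ^ 2 := by
    rw [L2Interval.norm_sq_eq, L2Interval.norm_sq_eq, ← integral_const_mul]
    refine integral_mono_ae (L2Interval.integrable_norm_sq _) (i0.const_mul _) ?_
    filter_upwards [coeFn_cutMul'' a b f, ae_restrict_mem measurableSet_Ioo] with t h1 h2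
    rw [h1, norm_smul, mul_pow, Real.norm_eq_abs, sq_abs, mul_pow]
    refine mul_le_mul_of_nonneg_right ?_ (sq_nonneg _)
    calc _ ≤ 1 * (36 / m ^ 4) := mul_le_mul hab
          (sq_edgeWeight'_le hm hml (Ioo_subset_Icc_self h2)) (sq_nonneg _) zero_le_one
      _ = _ := one_mul _
  have i1 : IntegrableOn (fun t => edgeWeight l t ^ 2 * ‖f₁ t‖ ^ 2) (Ioo 0 l) := by
    refine Integrable.bdd_mul (c := 36 / m ^ 2) f₁.integrable_norm_sq
      ((contDiff_edgeWeight l).continuous.pow 2).aestronglyMeasurable ?_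
    filter_upwards [ae_restrict_mem measurableSet_Ioo] with t ht
    rw [Real.norm_eq_abs, abs_of_nonneg (sq_nonneg _)]
    exact sq_edgeWeight_le hm hml (Ioo_subset_Icc_self ht)
  -- The derivative of the cut-off is itself an admissible Caccioppoli weight: its profile vanishes
  -- at both ends of the edge.
  have n2 : ‖cutMul' a b f₁‖ ^ 2 ≤ (4 * (36 / m ^ 4) + 2 * M * (36 / m ^ 2)) * ‖f‖ ^ 2 := by
    rw [L2Interval.norm_sq_eq f]
    refine le_trans ?_ (integral_weight_mul_sq_le hl h h' hu hu₁ hM (hasDerivAt_edgeWeight l)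
      (continuous_edgeWeight' l) (by simp [edgeWeight]) (by simp [edgeWeight]) fun t ht => ?_)
    · rw [L2Interval.norm_sq_eq]
      refine integral_mono_ae (L2Interval.integrable_norm_sq _) i1 ?_
      filter_upwards [coeFn_cutMul' a b f₁] with t h1
      rw [h1, norm_smul, mul_pow, Real.norm_eq_abs, sq_abs, mul_pow]
      refine mul_le_mul_of_nonneg_right ?_ (sq_nonneg _)
      exact mul_le_of_le_one_left (sq_nonneg _) hab
    · have := sq_edgeWeight_le hm hml ht
      have := sq_edgeWeight'_le hm hml ht
      gcongr
  have n3 := norm_add_le (cutMul'' a b f) ((2 : ℂ) • cutMul' a b f₁)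
  rw [norm_smul, Complex.norm_ofNat] at n3
  have n4 := pow_le_pow_left₀ (norm_nonneg _) n3 2
  -- `(x + 2y)² ≤ 2x² + 8y²` explains the factors `2` and `8` in the constant.
  nlinarith [sq_nonneg (‖cutMul'' a b f‖ - 2 * ‖cutMul' a b f₁‖)]

end EdgeCutoff

/-! ### Vertex values of the cut-off, and transfer between edge sets -/

namespace MetricGraph

variable {V E : Type*} (G : MetricGraph V E)

/-- The vertex values of a cut-off function may be replaced by `0` and `1`. -/
theorem IsCutoff.exists_vertex_values {G : MetricGraph V E} {E₁ E_A E₃ : Finset E}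
    {φ : E → ℝ → ℂ} (h : G.IsCutoff E₁ E_A E₃ φ) (hA : E_A ⊆ E₁) :
    ∃ c : V → ℝ, (∀ v, c v = 0 ∨ c v = 1) ∧ (∀ v ∈ G.bdryVerts E₁, c v = 0) ∧
      (∀ e ∈ E_A, c (G.i e) = 1 ∧ c (G.j e) = 1) ∧
      ∀ e ∈ E₁, e ∉ E₃ → c (G.i e) = c (G.j e) := by
  classical
  choose! z hz0 r hr hz using h.const_near
  have hi : ∀ e ∈ E₁, ∃ t ∈ Ioo 0 (G.l e), φ e t = z (G.i e) := by
    intro e he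
    have hv : G.i e ∈ G.verts E₁ := ⟨e, he, Or.inl rfl⟩
    have hm := lt_min (hr _ hv) (G.l_pos e)
    set m := min (r (G.i e)) (G.l e)
    have m1 : m ≤ r (G.i e) := min_le_left _ _
    have m2 : m ≤ G.l e := min_le_right _ _
    have ht : m / 2 ∈ Ioo 0 (G.l e) := ⟨by linarith, by linarith⟩
    refine ⟨m / 2, ht, hz _ hv ⟨(e, false), rfl⟩ he _ ht ?_⟩
    simp only [posAt, Bool.false_eq_true, if_false, sub_zero]
    rw [abs_of_pos ht.1]
    linarith
  have hj : ∀ e ∈ E₁, ∃ t ∈ Ioo 0 (G.l e), φ e t = z (G.j e) := by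
    intro e he
    have hv : G.j e ∈ G.verts E₁ := ⟨e, he, Or.inr rfl⟩
    have hm := lt_min (hr _ hv) (G.l_pos e)
    set m := min (r (G.j e)) (G.l e)
    have m1 : m ≤ r (G.j e) := min_le_left _ _
    have m2 : m ≤ G.l e := min_le_right _ _
    have ht : G.l e - m / 2 ∈ Ioo 0 (G.l e) := ⟨by linarith, by linarith⟩
    refine ⟨G.l e - m / 2, ht, hz _ hv ⟨(e, true), rfl⟩ he _ ht ?_⟩
    simp only [posAt, if_true]
    rw [show G.l e - m / 2 - G.l e = -(m / 2) by ring, abs_neg, abs_of_pos (by linarith)]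
    linarith
  -- Rounding: the value `1` is kept and every other value becomes `0`. This preserves the values
  -- `0` and `1` and all equalities between vertex values, which is all that is needed of `φ`.
  refine ⟨fun v => if v ∈ G.verts E₁ ∧ z v = 1 then 1 else 0, fun v => ?_, fun v hv => ?_,
    fun e he => ?_, fun e he he3 => ?_⟩
  · by_cases hh : v ∈ G.verts E₁ ∧ z v = 1 <;> simp [hh]
  · refine if_neg fun hh => ?_
    have := hz0 v hh.1 hv
    rw [hh.2] at this
    exact one_ne_zero this
  · obtain ⟨t, ht, ht'⟩ := hi e (hA he)
    obtain ⟨s, hs, hs'⟩ := hj e (hA he)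
    rw [h.eq_one e he t ht] at ht'
    rw [h.eq_one e he s hs] at hs'
    exact ⟨if_pos ⟨⟨e, hA he, Or.inl rfl⟩, ht'.symm⟩, if_pos ⟨⟨e, hA he, Or.inr rfl⟩, hs'.symm⟩⟩
  · obtain ⟨t, ht, ht'⟩ := hi e he
    obtain ⟨s, hs, hs'⟩ := hj e he
    -- Off `E₃` the function `φ` is constant along the edge, so the values near its two ends agree.
    have hconst : φ e t = φ e s :=
      isOpen_Ioo.is_const_of_deriv_eq_zero isPreconnected_Ioo
        ((h.smooth e he).differentiableOn (by simp)) (fun x hx => h.deriv_supp e he he3 x hx) ht hs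
    have e1 : G.i e ∈ G.verts E₁ := ⟨e, he, Or.inl rfl⟩
    have e2 : G.j e ∈ G.verts E₁ := ⟨e, he, Or.inr rfl⟩
    simp only [e1, e2, true_and, ← ht', ← hs', hconst]

variable {G}

open scoped Classical in
/-- Extension by zero of a family of functions on the edges in `E₁`. -/
def extend {E₁ : Finset E} (E₂ : Finset E) (f : G.L2 E₁) : G.L2 E₂ :=
  WithLp.toLp 2 fun e => if h : (e : E) ∈ E₁ then f ⟨e, h⟩ else 0

theorem extend_of_mem {E₁ E₂ : Finset E} (f : G.L2 E₁) (e : {e // e ∈ E₂}) (h : (e : E) ∈ E₁) :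
    extend E₂ f e = f ⟨e, h⟩ := dif_pos h

theorem extend_of_notMem {E₁ E₂ : Finset E} (f : G.L2 E₁) (e : {e // e ∈ E₂})
    (h : (e : E) ∉ E₁) : extend E₂ f e = 0 := dif_neg h

theorem norm_sq_extend {E₁ E₂ : Finset E} (hE : E₁ ⊆ E₂) (f : G.L2 E₁) :
    ‖extend E₂ f‖ ^ 2 = ‖f‖ ^ 2 := by
  classical
  rw [PiLp.norm_sq_eq_of_L2, PiLp.norm_sq_eq_of_L2]
  let q : E → ℝ := fun e => if h : e ∈ E₁ then ‖f ⟨e, h⟩‖ ^ 2 else 0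
  have h1 : ∀ e : {e // e ∈ E₂}, ‖extend E₂ f e‖ ^ 2 = q e := by
    intro e
    by_cases h : (e : E) ∈ E₁
    · rw [extend_of_mem f e h, show q e = _ from dif_pos h]
    · rw [extend_of_notMem f e h, show q e = _ from dif_neg h, norm_zero, zero_pow two_ne_zero]
  have h2 : ∀ e : {e // e ∈ E₁}, ‖f e‖ ^ 2 = q e := fun e => by
    rw [show q e = _ from dif_pos e.2]
  rw [Finset.sum_congr rfl fun e _ => h1 e, Finset.sum_congr rfl fun e _ => h2 e,
    Finset.sum_coe_sort E₂ q, Finset.sum_coe_sort E₁ q]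
  exact (Finset.sum_subset hE fun e _ h => dif_neg h).symm

/-- Restriction of a family of functions to a smaller set of edges. -/
def restrict {E₁ E₂ : Finset E} (hE : E₁ ⊆ E₂) (f : G.L2 E₂) : G.L2 E₁ :=
  WithLp.toLp 2 fun e => f ⟨e, hE e.2⟩

theorem norm_restrict_le {E₁ E₂ : Finset E} (hE : E₁ ⊆ E₂) (f : G.L2 E₂) :
    ‖restrict hE f‖ ≤ ‖f‖ := by
  refine le_of_sq_le_sq ?_ (norm_nonneg _)
  rw [← norm_sq_extend hE, PiLp.norm_sq_eq_of_L2, PiLp.norm_sq_eq_of_L2]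
  refine Finset.sum_le_sum fun e _ => ?_
  by_cases h : (e : E) ∈ E₁
  · rw [extend_of_mem _ e h]
    exact le_rfl
  · rw [extend_of_notMem _ e h, norm_zero, zero_pow two_ne_zero]
    exact sq_nonneg _

theorem ind_of_mem {F A : Finset E} (f : G.L2 F) (e : {e // e ∈ F}) (h : (e : E) ∈ A) :
    G.ind F A f e = f e := if_pos h

theorem ind_of_notMem {F A : Finset E} (f : G.L2 F) (e : {e // e ∈ F}) (h : (e : E) ∉ A) :
    G.ind F A f e = 0 := if_neg h

/-- The value at an edge end depends only on the vertex there, so the trace at a vertex is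
multiplied by a single scalar. -/
theorem edgeCutoff_posAt (c : V → ℝ) (p : E × Bool) :
    edgeCutoff (G.l p.1) (c (G.i p.1)) (c (G.j p.1)) (G.posAt p) = c (G.vertexAt p) := by
  obtain ⟨e, _ | _⟩ := p
  · simp [edgeCutoff, posAt, vertexAt]
  · simp only [edgeCutoff, posAt, vertexAt, if_true, div_self (G.l_pos e).ne']
    ring

theorem incident_star {v : V} (p : G.Star v) : G.Incident p.1.1 v := by
  obtain ⟨⟨e, _ | _⟩, hp⟩ := p
  · exact Or.inl hp
  · exact Or.inr hp

/-- Zero slope at the ends removes the term `χ' f` from the boundary values of `(χ f)'`, so the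
signed trace is scaled by the same number as the trace. -/
theorem edgeWeight_posAt (p : E × Bool) : edgeWeight (G.l p.1) (G.posAt p) = 0 := by
  obtain ⟨e, _ | _⟩ := p <;> simp [edgeWeight, posAt]

/-! ### Cut-off and extension by zero preserve operator domains -/

variable [∀ v, Fintype (G.Star v)] {S : ℝ}

theorem VertexCond.Holds.zero (B : G.VertexCond S) (v : V) : B.Holds v 0 0 :=
  ⟨Submodule.zero_mem _, by
    rw [map_zero, sub_zero]
    exact congrArg Subtype.val (map_zero (B.L v))⟩

/-- The product with the cut-off function with vertex values `c`, extended by zero. -/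
def cutExtend (c : V → ℝ) {E₁ : Finset E} (E₂ : Finset E) (f : G.L2 E₁) : G.L2 E₂ :=
  extend E₂ (WithLp.toLp 2 fun e => cutMul (c (G.i e)) (c (G.j e)) (f e))

/-- The derivative of `cutExtend`. -/
def cutExtend' (c : V → ℝ) {E₁ : Finset E} (E₂ : Finset E) (f f₁ : G.L2 E₁) : G.L2 E₂ :=
  extend E₂ (WithLp.toLp 2 fun e => cutMul' (c (G.i e)) (c (G.j e)) (f e) +
    cutMul (c (G.i e)) (c (G.j e)) (f₁ e))

/-- The second derivative of `cutExtend`. -/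
def cutExtend'' (c : V → ℝ) {E₁ : Finset E} (E₂ : Finset E) (f f₁ f₂ : G.L2 E₁) : G.L2 E₂ :=
  extend E₂ (WithLp.toLp 2 fun e =>
    (cutMul'' (c (G.i e)) (c (G.j e)) (f e) + cutMul' (c (G.i e)) (c (G.j e)) (f₁ e)) +
    (cutMul' (c (G.i e)) (c (G.j e)) (f₁ e) + cutMul (c (G.i e)) (c (G.j e)) (f₂ e)))

/-- Multiplication with a cut-off function vanishing at the boundary vertices maps the domain of
the operator on a subgraph to the domain of the operator on a larger subgraph. -/
theorem InDomain.cutExtend {B : G.VertexCond S} {E₁ E₂ : Finset E} (hE : E₁ ⊆ E₂) {c : V → ℝ}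
    (hc : ∀ v ∈ G.bdryVerts E₁, c v = 0) {f f₁ f₂ : G.L2 E₁} (h : G.InDomain B E₁ f f₁ f₂) :
    G.InDomain B E₂ (cutExtend c E₂ f) (cutExtend' c E₂ f f₁) (cutExtend'' c E₂ f f₁ f₂) := by
  classical
  obtain ⟨d1, d2, u, u₁, r, r₁, hi, hb⟩ := h
  refine ⟨fun e => ?_, fun e => ?_,
    fun e t => if e ∈ E₁ then edgeCutoff (G.l e) (c (G.i e)) (c (G.j e)) t • u e t else 0,
    fun e t => if e ∈ E₁ then ((c (G.j e) - c (G.i e)) * edgeWeight (G.l e) t) • u e t +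
      edgeCutoff (G.l e) (c (G.i e)) (c (G.j e)) t • u₁ e t else 0,
    fun e => ?_, fun e => ?_, fun v hv => ?_, fun v hv p hp => ?_⟩
  · by_cases he : (e : E) ∈ E₁
    · rw [MetricGraph.cutExtend, cutExtend', extend_of_mem _ e he, extend_of_mem _ e he]
      exact (d1 ⟨e, he⟩).cutMul (G.l_pos e)
    · rw [MetricGraph.cutExtend, cutExtend', extend_of_notMem _ e he, extend_of_notMem _ e he]
      exact HasWeakDeriv.zero _
  · by_cases he : (e : E) ∈ E₁
    · rw [cutExtend', cutExtend'', extend_of_mem _ e he, extend_of_mem _ e he]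
      exact (d1 ⟨e, he⟩).cutMul'.add ((d2 ⟨e, he⟩).cutMul (G.l_pos e))
    · rw [cutExtend', cutExtend'', extend_of_notMem _ e he, extend_of_notMem _ e he]
      exact HasWeakDeriv.zero _
  · by_cases he : (e : E) ∈ E₁
    · rw [MetricGraph.cutExtend, extend_of_mem _ e he]
      simp only [he, if_true]
      exact (r ⟨e, he⟩).contSMul _
    · rw [MetricGraph.cutExtend, extend_of_notMem _ e he]
      simp only [he, if_false]
      exact IsContRep.zero _
  · by_cases he : (e : E) ∈ E₁
    · rw [cutExtend', extend_of_mem _ e he]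
      simp only [he, if_true]
      exact ((r ⟨e, he⟩).contSMul _).add ((r₁ ⟨e, he⟩).contSMul _)
    · rw [cutExtend', extend_of_notMem _ e he]
      simp only [he, if_false]
      exact IsContRep.zero _
  · have hval : ∀ p : G.Star v, edgeCutoff (G.l p.1.1) (c (G.i p.1.1)) (c (G.j p.1.1))
        (G.posAt p.1) = c v := fun p => by rw [edgeCutoff_posAt, p.2]
    by_cases hv1 : v ∈ G.innerVerts E₁
    · have hmem : ∀ p : G.Star v, p.1.1 ∈ E₁ := fun p => hv1.2 _ (incident_star p)
      convert (hi v hv1).smul (c v : ℂ) using 1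
      · ext p
        simp [tr, hmem p, hval p]
      · ext p
        simp only [str, hmem p, hval p, edgeWeight_posAt, if_true, mul_zero, zero_smul, zero_add,
          PiLp.smul_apply, smul_eq_mul, Complex.real_smul]
        ring
    -- If `v` is not inner for `E₁`, then either no edge of `E₁` ends at `v` or `v` is a boundary
    -- vertex of `E₁` and `c v = 0`. In both cases all boundary data at `v` vanish and satisfy any
    -- linear condition.
    · have hc0 : ∀ p : G.Star v, p.1.1 ∈ E₁ → c v = 0 := by
        intro p hp
        refine hc v ⟨⟨_, hp, incident_star p⟩, ?_⟩
        by_contra hcon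
        push Not at hcon
        exact hv1 ⟨⟨_, hp, incident_star p⟩, fun e he => by_contra fun h' => hcon e h' he⟩
      convert VertexCond.Holds.zero B v using 1
      · ext p
        by_cases hp : p.1.1 ∈ E₁
        · simp [tr, hval p, hc0 p hp]
        · simp [tr, hp]
      · ext p
        by_cases hp : p.1.1 ∈ E₁
        · simp [str, hval p, hc0 p hp, edgeWeight_posAt]
        · simp [str, hp]
  · by_cases hp1 : p.1.1 ∈ E₁
    -- An edge at `v` outside `E₂` is also outside `E₁`, so a boundary vertex of `E₂` touched by
    -- `E₁` is a boundary vertex of `E₁`.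
    · obtain ⟨-, e, he, hev⟩ := hv
      have : c v = 0 := hc v ⟨⟨_, hp1, incident_star p⟩, e, fun h => he (hE h), hev⟩
      simp only [hp1, if_true, edgeCutoff_posAt, p.2, this, zero_smul]
    · simp only [hp1, if_false]

end MetricGraph

/-! ### The commutator and the resolvent identity -/

namespace MetricGraph

variable {V E : Type*} {G : MetricGraph V E}

/-- The commutator of `-d²/dx²` with the cut-off function with vertex values `c`, up to sign. -/
def cutCommutator (c : V → ℝ) {E₁ : Finset E} (E₂ : Finset E) (f f₁ : G.L2 E₁) : G.L2 E₂ :=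
  extend E₂ (WithLp.toLp 2 fun e => cutMul'' (c (G.i e)) (c (G.j e)) (f e) +
    (2 : ℂ) • cutMul' (c (G.i e)) (c (G.j e)) (f₁ e))

/-- The action of the operator on the product with a cut-off function. -/
theorem OpRel.cutExtend [∀ v, Fintype (G.Star v)] {S : ℝ} {B : G.VertexCond S}
    {W : E → ℝ → ℝ} {E₁ E₂ : Finset E} (hE : E₁ ⊆ E₂)
    {c : V → ℝ} (hc : ∀ v ∈ G.bdryVerts E₁, c v = 0) {f f₁ f₂ k : G.L2 E₁}
    (h : G.InDomain B E₁ f f₁ f₂) (hk : ∀ e, ∀ᵐ t ∂(volume.restrict (Ioo (0 : ℝ) (G.l e))),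
      k e t = - f₂ e t + (W e t : ℂ) * f e t) :
    G.OpRel B W E₂ (cutExtend c E₂ f) (cutExtend c E₂ k - cutCommutator c E₂ f f₁) := by
  refine ⟨_, _, h.cutExtend hE hc, fun e => ?_⟩
  rw [PiLp.sub_apply]
  by_cases he : (e : E) ∈ E₁
  -- Leibniz: `-(χ f)'' + W χ f = χ (-f'' + W f) - (χ'' f + 2 χ' f')`, checked pointwise almost
  -- everywhere.
  · simp only [MetricGraph.cutExtend, cutCommutator, cutExtend'', extend_of_mem _ e he]
    filter_upwards [hk ⟨e, he⟩, coeFn_cutMul (c (G.i e)) (c (G.j e)) (k ⟨e, he⟩),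
      coeFn_cutMul (c (G.i e)) (c (G.j e)) (f ⟨e, he⟩),
      coeFn_cutMul (c (G.i e)) (c (G.j e)) (f₂ ⟨e, he⟩),
      coeFn_cutMul' (c (G.i e)) (c (G.j e)) (f₁ ⟨e, he⟩),
      coeFn_cutMul'' (c (G.i e)) (c (G.j e)) (f ⟨e, he⟩),
      Lp.coeFn_sub (cutMul (c (G.i e)) (c (G.j e)) (k ⟨e, he⟩))
        (cutMul'' (c (G.i e)) (c (G.j e)) (f ⟨e, he⟩) +
          (2 : ℂ) • cutMul' (c (G.i e)) (c (G.j e)) (f₁ ⟨e, he⟩)),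
      Lp.coeFn_add (cutMul'' (c (G.i e)) (c (G.j e)) (f ⟨e, he⟩))
        ((2 : ℂ) • cutMul' (c (G.i e)) (c (G.j e)) (f₁ ⟨e, he⟩)),
      Lp.coeFn_smul (2 : ℂ) (cutMul' (c (G.i e)) (c (G.j e)) (f₁ ⟨e, he⟩)),
      Lp.coeFn_add (cutMul'' (c (G.i e)) (c (G.j e)) (f ⟨e, he⟩) +
          cutMul' (c (G.i e)) (c (G.j e)) (f₁ ⟨e, he⟩))
        (cutMul' (c (G.i e)) (c (G.j e)) (f₁ ⟨e, he⟩) +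
          cutMul (c (G.i e)) (c (G.j e)) (f₂ ⟨e, he⟩)),
      Lp.coeFn_add (cutMul'' (c (G.i e)) (c (G.j e)) (f ⟨e, he⟩))
        (cutMul' (c (G.i e)) (c (G.j e)) (f₁ ⟨e, he⟩)),
      Lp.coeFn_add (cutMul' (c (G.i e)) (c (G.j e)) (f₁ ⟨e, he⟩))
        (cutMul (c (G.i e)) (c (G.j e)) (f₂ ⟨e, he⟩))]
      with t a1 a2 a3 a4 a5 a6 b1 b2 b3 b4 b5 b6
    rw [b1, b4]
    simp only [Pi.sub_apply, Pi.add_apply]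
    rw [b2, b5, b6]
    simp only [Pi.add_apply]
    rw [b3, Pi.smul_apply, a2, a3, a4, a5, a6, a1]
    simp only [Complex.real_smul, smul_eq_mul]
    ring
  · simp only [MetricGraph.cutExtend, cutCommutator, cutExtend'', extend_of_notMem _ e he, sub_zero]
    filter_upwards [Lp.coeFn_zero ℂ 2 (volume.restrict (Ioo (0 : ℝ) (G.l e)))] with t ht
    rw [ht]
    simp

theorem cutMul_add_smul {l a b : ℝ} (z : ℂ) (f g : L2Interval l) :
    cutMul a b (z • f + g) = z • cutMul a b f + cutMul a b g := by
  apply Lp.ext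
  filter_upwards [coeFn_cutMul a b (z • f + g), coeFn_cutMul a b f, coeFn_cutMul a b g,
    Lp.coeFn_add (z • cutMul a b f) (cutMul a b g), Lp.coeFn_smul z (cutMul a b f),
    Lp.coeFn_add (z • f) g, Lp.coeFn_smul z f] with t a1 a2 a3 a4 a5 a6 a7
  simp only [a1, a4, Pi.add_apply, a5, a6, Pi.smul_apply, a7, a2, a3, smul_add, smul_comm z]

theorem cutMul_one {l : ℝ} (f : L2Interval l) : cutMul 1 1 f = f := by
  apply Lp.ext
  filter_upwards [coeFn_cutMul 1 1 f] with t ht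
  rw [ht]
  simp [edgeCutoff]

theorem cutMul_zero {l a b : ℝ} : cutMul a b (0 : L2Interval l) = 0 := by
  simpa using cutMul_add_smul (a := a) (b := b) (-1) (0 : L2Interval l) 0

theorem cutCommutator_apply_of_eq {c : V → ℝ} {E₁ E₂ : Finset E} (f f₁ : G.L2 E₁)
    (e : {e // e ∈ E₂}) (h : (e : E) ∈ E₁ → c (G.i e) = c (G.j e)) :
    cutCommutator c E₂ f f₁ e = 0 := by
  by_cases he : (e : E) ∈ E₁
  · simp only [cutCommutator, extend_of_mem _ e he, h he, cutMul'_self, cutMul''_self, smul_zero,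
      add_zero]
  · exact extend_of_notMem _ e he

/-- The resolvent equation with cut-off. -/
theorem resOp_cutExtend [∀ v, Fintype (G.Star v)] {S : ℝ} {B : G.VertexCond S}
    {W : E → ℝ → ℝ} {E₁ E₂ E_A : Finset E} (hE : E₁ ⊆ E₂) (hA : E_A ⊆ E₁) {c : V → ℝ}
    (hc : ∀ v ∈ G.bdryVerts E₁, c v = 0) (hcA : ∀ e ∈ E_A, c (G.i e) = 1 ∧ c (G.j e) = 1) {z : ℂ}
    (h₂ : z ∈ resSet (G.op B W E₂)) (g : G.L2 E₂) {f f₁ f₂ : G.L2 E₁}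
    (h : G.InDomain B E₁ f f₁ f₂) (hk : ∀ e, ∀ᵐ t ∂(volume.restrict (Ioo (0 : ℝ) (G.l e))),
      (z • f + G.ind E₁ E_A (restrict hE g)) e t = - f₂ e t + (W e t : ℂ) * f e t) :
    resOp (G.op B W E₂) z (G.ind E₂ E_A g - cutCommutator c E₂ f f₁) = cutExtend c E₂ f := by
  rw [isResolventAt_resOp h₂]
  obtain ⟨hf, he⟩ := (op_apply_eq_iff G).2 (OpRel.cutExtend hE hc h hk)
  refine ⟨hf, ?_⟩
  -- The commutator cancels on both sides. What is left is `χ (z f + 1_A g) - z χ f = 1_A g`, which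
  -- holds because `χ = 1` on the edges of `E_A`.
  rw [he, sub_right_comm]
  congr 1
  ext1 e
  rw [PiLp.sub_apply, PiLp.smul_apply]
  by_cases he : (e : E) ∈ E₁
  · simp only [MetricGraph.cutExtend, extend_of_mem _ e he, PiLp.add_apply, PiLp.smul_apply,
      cutMul_add_smul, add_sub_cancel_left]
    by_cases heA : (e : E) ∈ E_A
    · rw [ind_of_mem _ e heA, ind_of_mem _ ⟨(e : E), he⟩ heA, (hcA e heA).1, (hcA e heA).2, cutMul_one]
      rfl
    · rw [ind_of_notMem _ e heA, ind_of_notMem _ ⟨(e : E), he⟩ heA, cutMul_zero]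
  · simp only [MetricGraph.cutExtend, extend_of_notMem _ e he, smul_zero, sub_zero]
    exact (ind_of_notMem _ _ fun hh => he (hA hh)).symm

end MetricGraph

end

/-! ### The geometric resolvent inequality -/

open MetricGraph

theorem mainTheorem5
    (S lm qm qp cm cp : ℝ) (hS : 0 < S) (hlm : 0 < lm) (hq : qm < qp) (hcm : 0 < cm)
    (hc : cm ≤ cp) (I : Set ℝ) (hI : I.OrdConnected) (hIb : Bornology.IsBounded I) :
    ∃ C : ℝ, 0 < C ∧
      ∀ (V E : Type*) [Countable V] [Countable E] (G : MetricGraph V E)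
        [∀ v, Fintype (G.Star v)] (lp : ℝ), (∀ e, lm ≤ G.l e ∧ G.l e ≤ lp) →
      ∀ (B : G.VertexCond S) (ν : E → ℝ → ℝ) (om : E → ℝ),
        (∀ e, AEMeasurable (ν e) (volume.restrict (Ioo 0 (G.l e)))) →
        (∀ e, ∀ᵐ t ∂(volume.restrict (Ioo 0 (G.l e))), cm ≤ ν e t ∧ ν e t ≤ cp) →
        (∀ e, om e ∈ Icc qm qp) →
      ∀ (E₁ E₂ E_A E_B E₃ E₄ : Finset E) (φ : E → ℝ → ℂ) (lam : ℝ),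
        E₁ ⊆ E₂ → E_A ⊆ E₁ → E_B ⊆ E₂ → Disjoint E_B E₁ →
        E₃ ⊆ E₄ → E₄ ⊆ E₁ → G.bdryVerts E₃ ⊆ G.innerVerts E₄ → Disjoint E_A E₄ →
        G.IsCutoff E₁ E_A E₃ φ →
        lam ∈ I →
        (lam : ℂ) ∈ resSet (G.op B (fun e t => om e * ν e t) E₁) →
        (lam : ℂ) ∈ resSet (G.op B (fun e t => om e * ν e t) E₂) →
        ‖G.ind E₂ E_B ∘L resOp (G.op B (fun e t => om e * ν e t) E₂) lam ∘L G.ind E₂ E_A‖ ≤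
          C * ‖G.ind E₂ E_B ∘L resOp (G.op B (fun e t => om e * ν e t) E₂) lam ∘L G.ind E₂ E₄‖ *
            ‖G.ind E₁ E₄ ∘L resOp (G.op B (fun e t => om e * ν e t) E₁) lam ∘L G.ind E₁ E_A‖ := by
  obtain ⟨R, hR⟩ := hIb.exists_norm_le
  -- A bound for `|ω ν - λ|`. The absolute value of `R` is taken because for empty `I` the bound `R`
  -- may be negative.
  set M : ℝ := max |qm| |qp| * cp + |R| with hMdef
  have hcp : 0 < cp := hcm.trans_le hc
  have hM0 : 0 ≤ M := by positivity
  set D : ℝ := 2 * (36 / lm ^ 4) + 8 * (4 * (36 / lm ^ 4) + 2 * M * (36 / lm ^ 2)) with hD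
  have hDpos : 0 < D := by positivity
  refine ⟨√D, Real.sqrt_pos.2 hDpos, ?_⟩
  intro V E _ _ G _ lp hl B ν om _ hν hom E₁ E₂ E_A E_B E₃ E₄ φ lam hE hA _ hB h34 _ _ hA4 hφ
    hlam h₁ h₂
  set W : E → ℝ → ℝ := fun e t => om e * ν e t with hW
  have hWb : ∀ e, ∀ᵐ t ∂(volume.restrict (Ioo 0 (G.l e))), ‖((W e t : ℂ) - lam)‖ ≤ M := by
    intro e
    filter_upwards [hν e] with t ht
    refine (norm_sub_le _ _).trans ?_
    rw [Complex.norm_real, Complex.norm_real, hW, norm_mul]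
    refine add_le_add (mul_le_mul ?_ ?_ (norm_nonneg _) (by positivity))
      ((hR lam hlam).trans (le_abs_self R))
    · exact abs_le_max_abs_abs (hom e).1 (hom e).2
    · rw [Real.norm_eq_abs, abs_of_pos (hcm.trans_le ht.1)]
      exact ht.2
  obtain ⟨c, c01, cb, cA, c3⟩ := hφ.exists_vertex_values hA
  have hcsq : ∀ v v', (c v' - c v) ^ 2 ≤ 1 := by
    intro v v'
    rcases c01 v with h | h <;> rcases c01 v' with h' | h' <;> rw [h, h'] <;> norm_num
  refine ContinuousLinearMap.opNorm_le_bound _ (by positivity) fun g => ?_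
  set f := resOp (G.op B W E₁) lam (G.ind E₁ E_A (restrict hE g)) with hf
  have hrel : G.OpRel B W E₁ f ((lam : ℂ) • f + G.ind E₁ E_A (restrict hE g)) := by
    obtain ⟨hd, he⟩ := (isResolventAt_resOp h₁ f (G.ind E₁ E_A (restrict hE g))).1 hf.symm
    refine (op_apply_eq_iff G).1 ⟨hd, ?_⟩
    rw [← he]
    abel
  obtain ⟨f₁, f₂, hdom, heq⟩ := hrel
  have hres := resOp_cutExtend hE hA cb cA h₂ g hdom heq
  set k := cutCommutator c E₂ f f₁ with hk
  have hk0 : ∀ e : {e // e ∈ E₂}, ((e : E) ∈ E₁ → (e : E) ∉ E₃) → k e = 0 := fun e he =>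
    cutCommutator_apply_of_eq f f₁ e fun h1 => c3 e h1 (he h1)
  have hk4 : G.ind E₂ E₄ k = k := by
    ext1 e
    by_cases he : (e : E) ∈ E₄
    · exact ind_of_mem _ _ he
    · rw [ind_of_notMem _ _ he, hk0 e fun _ h3 => he (h34 h3)]
  -- `χ f` lives on `E₁`, which `E_B` does not meet; this eliminates the left-hand term of the
  -- resolvent identity.
  have hB0 : G.ind E₂ E_B (cutExtend c E₂ f) = 0 := by
    ext1 e
    by_cases he : (e : E) ∈ E_B
    · rw [ind_of_mem _ _ he]
      exact extend_of_notMem _ _ (Finset.disjoint_left.1 hB he)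
    · exact ind_of_notMem _ _ he
  have hmain : G.ind E₂ E_B (resOp (G.op B W E₂) lam (G.ind E₂ E_A g)) =
      G.ind E₂ E_B (resOp (G.op B W E₂) lam (G.ind E₂ E₄ k)) := by
    rw [hk4, ← sub_eq_zero, ← map_sub, ← map_sub, hres, hB0]
  have hkn : ‖k‖ ≤ √D * ‖G.ind E₁ E₄ f‖ := by
    refine le_of_sq_le_sq ?_ (by positivity)
    -- Extending `1_{E₄} f` by zero turns both sides into sums over `E₂`, to be compared edge by
    -- edge.
    rw [mul_pow, Real.sq_sqrt hDpos.le, ← norm_sq_extend hE, PiLp.norm_sq_eq_of_L2,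
      PiLp.norm_sq_eq_of_L2, Finset.mul_sum]
    refine Finset.sum_le_sum fun e _ => ?_
    by_cases he : (e : E) ∈ E₁ ∧ (e : E) ∈ E₃
    · obtain ⟨he1, he3⟩ := he
      rw [hk, cutCommutator, extend_of_mem _ e he1, extend_of_mem _ e he1,
        ind_of_mem _ ⟨(e : E), he1⟩ (h34 he3)]
      obtain ⟨d1, d2, u, u₁, r, r₁, -⟩ := hdom
      refine norm_commutator_sq_le hlm (hl e).1 hM0 (hcsq _ _) (d1 ⟨e, he1⟩) (d2 ⟨e, he1⟩)
        (r ⟨e, he1⟩) (r₁ ⟨e, he1⟩) ?_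
      -- On an edge of `E₃ ⊆ E₄` the source `1_A g` is absent, so `f'' = (W - λ) f` holds there and
      -- the edge estimate applies.
      have hz : G.ind E₁ E_A (restrict hE g) ⟨e, he1⟩ = 0 :=
        ind_of_notMem _ _ (Finset.disjoint_right.1 hA4 (h34 he3))
      have heq1 := heq ⟨e, he1⟩
      rw [PiLp.add_apply, hz, add_zero, PiLp.smul_apply] at heq1
      filter_upwards [heq1, hWb e, Lp.coeFn_smul (lam : ℂ) (f ⟨e, he1⟩)] with t a1 a2 a3
      rw [a3, Pi.smul_apply, smul_eq_mul] at a1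
      have : f₂ ⟨e, he1⟩ t = ((W e t : ℂ) - lam) * f ⟨e, he1⟩ t := by
        linear_combination a1
      rw [this, norm_mul]
      exact mul_le_mul_of_nonneg_right a2 (norm_nonneg _)
    · rw [hk0 e fun h1 h3 => he ⟨h1, h3⟩, norm_zero, zero_pow two_ne_zero]
      positivity
  have hn1 : ‖G.ind E₁ E₄ f‖ ≤
      ‖G.ind E₁ E₄ ∘L resOp (G.op B W E₁) lam ∘L G.ind E₁ E_A‖ * ‖g‖ :=
    ((G.ind E₁ E₄ ∘L resOp (G.op B W E₁) lam ∘L G.ind E₁ E_A).le_opNorm (restrict hE g)).trans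
      (mul_le_mul_of_nonneg_left (norm_restrict_le hE g) (norm_nonneg _))
  have hn2 : ‖G.ind E₂ E_B (resOp (G.op B W E₂) lam (G.ind E₂ E₄ k))‖ ≤
      ‖G.ind E₂ E_B ∘L resOp (G.op B W E₂) lam ∘L G.ind E₂ E₄‖ * ‖k‖ :=
    (G.ind E₂ E_B ∘L resOp (G.op B W E₂) lam ∘L G.ind E₂ E₄).le_opNorm k
  change ‖G.ind E₂ E_B (resOp (G.op B W E₂) lam (G.ind E₂ E_A g))‖ ≤ _
  rw [hmain]
  calc _ ≤ ‖G.ind E₂ E_B ∘L resOp (G.op B W E₂) lam ∘L G.ind E₂ E₄‖ * ‖k‖ := hn2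
    _ ≤ ‖G.ind E₂ E_B ∘L resOp (G.op B W E₂) lam ∘L G.ind E₂ E₄‖ * (√D *
        (‖G.ind E₁ E₄ ∘L resOp (G.op B W E₁) lam ∘L G.ind E₁ E_A‖ * ‖g‖)) := by
      gcongr
      exact hkn.trans (mul_le_mul_of_nonneg_left hn1 (Real.sqrt_nonneg _))
    _ = _ := by ring
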